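/- **Theorem 5.** Let $\rho,\sigma$ be density matrices of dimension $d$, write $[n]=\{1,\dots,n\}$, and for integers $k,l\ge 1$ and $\varepsilon\in(0,1)$ put $$L=\Big\lfloor \ln\tfrac{4k+4l}{\varepsilon}\Big\rfloor ,\qquad \tilde R=\min\{\max\{\operatorname{rank}\rho,\operatorname{rank}\sigma\},\,L\}.$$ There are absolute constants $C>0$ and $c,K_0\in\mathbb N$ such that for all $k,l\ge1$ with $k+l\ge K_0$, all $\varepsilon,\delta\in(0,1)$ and every integer $t\ge 0$ there is a protocol, depending only on $k,l,\varepsilon,\delta,t$ (not on $d,\rho,\sigma$), as follows. Let $s=\min\{t,L\}$. 1. *Quantum part.* Only the quantities $\operatorname{Tr}(\rho^i)$, $\operatorname{Tr}(\sigma^j)$ and $\operatorname{Tr}(\rho^i\sigma^j)$ with $i,j\in[s]$ (so $i,j\le t$) are estimated on the quantum device. Each is estimated by the sample mean of the $\pm1$ outcomes (parity of the measured ancilla bits) of independent runs of one circuit on fresh copies of $\rho$ and $\sigma$. The circuit consists of Hadamard gates on ancilla qubits and controlled swaps (CSWAP) of registers holding one copy each, and its expected outcome equals the quantity. Each circuit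 has $O(t)$ qubits (at most $C\,n\,t$ if the states are states of $n$ qubits) and at most $C\,t$ CSWAPs. 2. *Classical part.* Let $Q^\rho_i,Q^\sigma_j,Q_{i,j}$ ($i,j\in[s]$) be the estimates obtained. Let $b_0=1$ and $b_m=\frac1m\sum_{i=1}^m(-1)^{i-1}b_{m-i}Q^\sigma_i$ for $m\in[s]$, and let $a_m$ be defined in the same way from $Q^\rho$. Set $Q_{i,j}=\sum_{m=1}^{s}(-1)^{m-1}b_m\,Q_{i,j-m}$ for $i\le s$ and $j>s$, and then $Q_{i,j}=\sum_{m=1}^{s}(-1)^{m-1}a_m\,Q_{i-m,j}$ for $i>s$ and $j\ge1$. The output is $(Q_{i,j})_{(i,j)\in[k]\times[l]}$. 3. *Copies.* The total number of copies used is $\tilde O(k^2/\varepsilon^2)$ for $\rho$ and $\tilde O(l^2/\varepsilon^2)$ for $\sigma$, namely at most $$C\,\frac{k^2}{\varepsilon^2}\Big(1+\ln\frac{k+l}{\varepsilon}\Big)^{c}\ln\frac2\delta\quad\text{and}\quad C\,\frac{l^2}{\varepsilon^2}\Big(1+\ln\frac{k+l}{\varepsilon}\Big)^{c}\ln\frac2\delta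 .$$ 4. *Accuracy.* For all $d$ and all density matrices $\rho,\sigma$ of dimension $d$ with $t\ge\tilde R$, with probability at least $1-\delta$ one has $|Q_{i,j}-\operatorname{Tr}(\rho^i\sigma^j)|\le\varepsilon$ simultaneously for all $(i,j)\in[k]\times[l]$. -/

import Mathlib

open scoped Matrix BigOperators ComplexOrder

noncomputable section

/-- `ρ` is a quantum state (density matrix) of a `d`-level system. -/
def IsDensityMatrix {d : ℕ} (ρ : Matrix (Fin d) (Fin d) ℂ) : Prop :=
  ρ.PosSemidef ∧ ρ.trace = 1

/-- The two unknown states of which copies are available. -/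
inductive Source
  | rho
  | sigma
  deriving DecidableEq

/-- The state that a source produces. -/
def Source.state {d : ℕ} (ρ σ : Matrix (Fin d) (Fin d) ℂ) : Source → Matrix (Fin d) (Fin d) ℂ
  | .rho => ρ
  | .sigma => σ

/-- Gates on `a` ancilla qubits and `m` registers, each register holding one copy of a state:
a Hadamard gate on an ancilla, and the swap of two registers controlled by an ancilla. -/
inductive Gate (a m : ℕ)
  | hadamard (q : Fin a)
  | cswap (control : Fin a) (r s : Fin m)

/-- Computational basis labels of `a` ancilla qubits and `m` registers of dimension `d`. -/
abbrev BasisLabel (a m d : ℕ) : Type := (Fin a → Bool) × (Fin m → Fin d)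

/-- The unitary matrix of a gate. -/
def Gate.matrix {a m : ℕ} (d : ℕ) :
    Gate a m → Matrix (BasisLabel a m d) (BasisLabel a m d) ℂ
  | .hadamard q => fun x y =>
      if x.2 = y.2 ∧ ∀ p, p ≠ q → x.1 p = y.1 p then
        ((1 / Real.sqrt 2 : ℝ) : ℂ) * (if x.1 q = true ∧ y.1 q = true then -1 else 1)
      else 0
  | .cswap c r s => fun x y =>
      if x.1 = y.1 ∧ x.2 = (if y.1 c = true then y.2 ∘ Equiv.swap r s else y.2) then 1 else 0

/-- A circuit: ancilla qubits (all prepared in `|0⟩`), registers, the source of the state that is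
loaded into each register, and the gates in the order in which they are applied. At the end
all ancilla qubits are measured in the computational basis. The description of a circuit does
not involve the dimension of the states. -/
structure Circuit where
  ancillas : ℕ
  registers : ℕ
  input : Fin registers → Source
  gates : List (Gate ancillas registers)

namespace Circuit

/-- Number of copies of the state of source `s` that one run of the circuit consumes. -/
def copies (c : Circuit) (s : Source) : ℕ :=
  (Finset.univ.filter fun r => c.input r = s).card

/-- Number of qubits of the circuit when every copy is a state of `n` qubits. -/
def qubits (c : Circuit) (n : ℕ) : ℕ := c.ancillas + c.registers * n

/-- Number of controlled swaps of registers in the circuit. -/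
def cswaps (c : Circuit) : ℕ :=
  c.gates.countP fun g => match g with
    | .cswap _ _ _ => true
    | .hadamard _ => false

/-- The initial state `|0⋯0⟩⟨0⋯0| ⊗ ω₁ ⊗ ⋯ ⊗ ωₘ`, each `ωᵣ` being `ρ` or `σ`. -/
def initialState (c : Circuit) {d : ℕ} (ρ σ : Matrix (Fin d) (Fin d) ℂ) :
    Matrix (BasisLabel c.ancillas c.registers d) (BasisLabel c.ancillas c.registers d) ℂ :=
  fun x y =>
    (if (∀ q, x.1 q = false) ∧ (∀ q, y.1 q = false) then 1 else 0) *
      ∏ r, (c.input r).state ρ σ (x.2 r) (y.2 r)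

/-- The state after all gates: each gate `G` maps the state `τ` to `G τ Gᴴ`. -/
def finalState (c : Circuit) {d : ℕ} (ρ σ : Matrix (Fin d) (Fin d) ℂ) :
    Matrix (BasisLabel c.ancillas c.registers d) (BasisLabel c.ancillas c.registers d) ℂ :=
  c.gates.foldl (fun τ g => g.matrix d * τ * (g.matrix d)ᴴ) (c.initialState ρ σ)

/-- Born rule: the probability that measuring the ancilla qubits gives the bit string `x`. -/
def outcomeProb (c : Circuit) {d : ℕ} (ρ σ : Matrix (Fin d) (Fin d) ℂ)
    (x : Fin c.ancillas → Bool) : ℝ :=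
  (∑ u : Fin c.registers → Fin d, c.finalState ρ σ (x, u) (x, u)).re

/-- The law of the measurement outcome of one run. -/
def outcomeLaw (c : Circuit) {d : ℕ} (ρ σ : Matrix (Fin d) (Fin d) ℂ) :
    MeasureTheory.Measure (Fin c.ancillas → Bool) :=
  ∑ x, ENNReal.ofReal (c.outcomeProb ρ σ x) • MeasureTheory.Measure.dirac x

/-- The number `±1` read off from a measurement outcome: the parity of the outcome bits. -/
def signValue (c : Circuit) (x : Fin c.ancillas → Bool) : ℝ :=
  ∏ q, if x q = true then -1 else 1

end Circuit

/-- The quantities estimated on the quantum device for a cutoff `s`: `Tr(ρ^i)`, `Tr(σ^j)` and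
`Tr(ρ^i σ^j)` for `1 ≤ i, j ≤ s`, in this order. -/
abbrev Quantity (s : ℕ) : Type :=
  Finset.Icc 1 s ⊕ Finset.Icc 1 s ⊕ (Finset.Icc 1 s × Finset.Icc 1 s)

/-- The exact value of a quantity. -/
def Quantity.value {s d : ℕ} (ρ σ : Matrix (Fin d) (Fin d) ℂ) : Quantity s → ℂ
  | .inl i => (ρ ^ (i : ℕ)).trace
  | .inr (.inl j) => (σ ^ (j : ℕ)).trace
  | .inr (.inr ij) => (ρ ^ (ij.1 : ℕ) * σ ^ (ij.2 : ℕ)).trace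

/-- Elementary symmetric polynomials computed from power sums `Q 1, Q 2, …` by the
Newton-Girard recursion `b₀ = 1`, `bₖ = (1/k) ∑_{i=1}^{k} (-1)^(i-1) b_{k-i} Q_i`. -/
def newtonGirard (Q : ℕ → ℝ) : ℕ → ℝ
  | 0 => 1
  | k + 1 => (1 / ((k : ℝ) + 1)) *
      ∑ i : Fin (k + 1), (-1) ^ (i : ℕ) * newtonGirard Q (k - i) * Q (i + 1)
  termination_by k => k
  decreasing_by omega

/-- Continuation of `q 1, …, q t` to all indices by the recurrence
`q n = ∑_{m=1}^{t} (-1)^(m-1) bₘ q (n-m)` for `n > t`. -/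
def extend (t : ℕ) (b q : ℕ → ℝ) (n : ℕ) : ℝ :=
  if n ≤ t then q n
  else ∑ m : Fin t, (-1) ^ (m : ℕ) * b (m + 1) * extend t b q (n - (m + 1))
  termination_by n
  decreasing_by have := m.isLt; omega

/-- The classical post-processing. From estimates of all quantities with cutoff `s` it first
continues, for each `i ≤ s`, the estimates of `Tr(ρ^i σ^j)` in `j`, with the coefficients obtained
from the estimates of `Tr(σ^j)`, and then, for each `j`, continues in `i` with the coefficients
obtained from the estimates of `Tr(ρ^i)`. -/
def postProcess (s : ℕ) (Q : Quantity s → ℝ) (i j : ℕ) : ℝ :=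
  let Qρ : ℕ → ℝ := fun i => if h : i ∈ Finset.Icc 1 s then Q (.inl ⟨i, h⟩) else 0
  let Qσ : ℕ → ℝ := fun j => if h : j ∈ Finset.Icc 1 s then Q (.inr (.inl ⟨j, h⟩)) else 0
  let Qρσ : ℕ → ℕ → ℝ := fun i j =>
    if h : i ∈ Finset.Icc 1 s ∧ j ∈ Finset.Icc 1 s then
      Q (.inr (.inr (⟨i, h.1⟩, ⟨j, h.2⟩))) else 0
  extend s (newtonGirard Qρ) (fun i' => extend s (newtonGirard Qσ) (Qρσ i') j) i

/-- The quantum part of an estimation protocol: a cutoff, and for every quantity a circuit and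
the number of times it is run, always on fresh copies of the states. -/
structure Protocol where
  cutoff : ℕ
  circuit : Quantity cutoff → Circuit
  runs : Quantity cutoff → ℕ

namespace Protocol

/-- Total number of copies of the state of source `s` consumed by the protocol. -/
def copies (P : Protocol) (s : Source) : ℕ := ∑ q, P.runs q * (P.circuit q).copies s

/-- The record of the measurement outcomes of all runs. -/
abbrev Record (P : Protocol) : Type :=
  (q : Quantity P.cutoff) → Fin (P.runs q) → Fin (P.circuit q).ancillas → Bool

/-- The joint law of the outcomes: the runs are independent. -/
def law (P : Protocol) {d : ℕ} (ρ σ : Matrix (Fin d) (Fin d) ℂ) :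
    MeasureTheory.Measure P.Record :=
  MeasureTheory.Measure.pi fun q =>
    MeasureTheory.Measure.pi fun _ => (P.circuit q).outcomeLaw ρ σ

/-- The estimate of a quantity: the mean of the signs observed in its runs. -/
def estimate (P : Protocol) (ω : P.Record) (q : Quantity P.cutoff) : ℝ :=
  (∑ n, (P.circuit q).signValue (ω q n)) / P.runs q

/-- The estimate of `Tr(ρ^i σ^j)`, for any `i, j ≥ 1`. -/
def output (P : Protocol) (ω : P.Record) (i j : ℕ) : ℝ :=
  postProcess P.cutoff (P.estimate ω) i j

end Protocol

end

/-! The moments of the two states are `Tr(ρ^i σ^j) = ∑ p a b * x a ^ i * y b ^ j`, where `x`, `y`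
are the spectra and `p` is the doubly stochastic matrix of squared overlaps
(`exists_doublyStochastic_trace_eq`). With one exponent fixed they form a sequence `∑ w a * x a ^ n`
with weights in `[0, 1]` and `x` a probability vector. The classical part continues such sequences
by a linear recurrence, and the crux is that errors in the coefficients and in the initial data are
not amplified exponentially.

This is seen on generating series. Let `A = ∏ (1 - x a X)` and `H = 1 / A`. Since `∑ x a = 1`, the
coefficients of `A` are at most `1 / n!` in absolute value and those of `H` lie in `[0, 1]`.
Newton's identities say `X A' = -A P` with `P` the series of power sums, and the Newton-Girard
output `B` satisfies the same equation with the estimated power sums. Hence `R = B H` satisfies `X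
R' = -R (P_est - P)`, which keeps the coefficients of `R - 1` below the estimation error `η`; from
`B - A = (R - 1) A` those of `B - A` are at most `3 η` (`abs_newtonGirardSeries_sub_le`).

For the continuation, let `D` be `B` truncated at degree `s`, `G` the true series, `F` the error
series. Beyond degree `s` the product of `D` with the continued series vanishes, while `A G` is a
polynomial with factorially small coefficients. So `D F` is small, and `F = (D F) H - F (D - A) H`
is a Gronwall inequality whose rate times the final index is at most 1. This gives
`abs_extend_newtonGirard_sub_le`; applying it in `j` and then in `i` gives `abs_postProcess_sub_le`.

The tail beyond `s` disappears if `s` is at least both ranks. Otherwise `s = L`, and `L!` beats `L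
(k + l) / ε`, because `e ^ (L + 1)` exceeds `4 (k + l) / ε` and factorials outgrow exponentials.

On the quantum side a cyclic swap test has expectation `Tr(ρ^i σ^j)`, and Hoeffding with a union
bound controls all estimates. Errors in `Tr(ρ^i)` are amplified by `k`, in `Tr(σ^j)` by `l`, in
mixed moments by neither, up to powers of `s`. Adapting the precision to this separates the copy
counts of the two states. -/

open PowerSeries in
theorem PowerSeries.coeff_succ_one_sub_C_mul_X_mul (c : ℝ) (P : PowerSeries ℝ) (n : ℕ) :
    coeff (n + 1) ((1 - C c * X) * P) = coeff (n + 1) P - c * coeff n P := by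
  rw [sub_mul, one_mul, mul_assoc, map_sub, coeff_C_mul, coeff_succ_X_mul]

open PowerSeries in
theorem PowerSeries.coeff_zero_one_sub_C_mul_X_mul (c : ℝ) (P : PowerSeries ℝ) :
    coeff 0 ((1 - C c * X) * P) = coeff 0 P := by
  simp

theorem pow_succ_add_mul_le_add_pow {x y : ℝ} (hx : 0 ≤ x) (hy : 0 ≤ y) (n : ℕ) :
    y ^ (n + 1) + (n + 1) * (x * y ^ n) ≤ (x + y) ^ (n + 1) := by
  induction n with
  | zero => simp [add_comm]
  | succ n ih =>
    have h := mul_le_mul_of_nonneg_left ih (add_nonneg hx hy)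
    have h1 : 0 ≤ x * x * y ^ n := by positivity
    have h2 : 0 ≤ (n : ℝ) * (x * x * y ^ n) := by positivity
    rw [pow_succ (x + y) (n + 1)]
    push_cast
    ring_nf at h h1 h2 ⊢
    linarith

/-! ### Generating series: elementary and complete symmetric polynomials, Newton's identities. -/

section Series

open PowerSeries

variable {ι : Type*}

/-- Up to sign the coefficient is the elementary symmetric polynomial, and each of its monomials
occurs `n!` times in the expansion of `(∑ x a) ^ n`. The induction uses the first two terms of the
binomial expansion. -/
theorem abs_coeff_prod_one_sub_le (S : Finset ι) (x : ι → ℝ) (hx : ∀ a, 0 ≤ x a) (n : ℕ) :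
    |coeff n (∏ a ∈ S, (1 - C (x a) * X : PowerSeries ℝ))| ≤
      (∑ a ∈ S, x a) ^ n / n.factorial := by
  classical
  induction S using Finset.induction_on generalizing n with
  | empty =>
    cases n <;> simp [coeff_one]
  | insert a S ha ih =>
    rw [Finset.prod_insert ha, Finset.sum_insert ha]
    have hS : 0 ≤ ∑ a ∈ S, x a := Finset.sum_nonneg fun a _ => hx a
    cases n with
    | zero =>
      rw [coeff_zero_one_sub_C_mul_X_mul]
      simp
    | succ n =>
      rw [coeff_succ_one_sub_C_mul_X_mul]
      refine (abs_sub _ _).trans ?_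
      rw [abs_mul, abs_of_nonneg (hx a)]
      refine (add_le_add (ih (n + 1)) (mul_le_mul_of_nonneg_left (ih n) (hx a))).trans ?_
      have h := pow_succ_add_mul_le_add_pow (hx a) hS n
      have hf : (0 : ℝ) < n.factorial := by positivity
      rw [Nat.factorial_succ]
      push_cast
      rw [div_add' _ _ _ (by positivity), div_le_div_iff_of_pos_right (by positivity)]
      refine le_trans (le_of_eq ?_) h
      field_simp

theorem coeff_prod_one_sub_eq_zero (S : Finset ι) (x : ι → ℝ) (n : ℕ)
    (hn : (S.filter fun a => x a ≠ 0).card < n) :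
    coeff n (∏ a ∈ S, (1 - C (x a) * X : PowerSeries ℝ)) = 0 := by
  classical
  induction S using Finset.induction_on generalizing n with
  | empty =>
    have : n ≠ 0 := by rintro rfl; simp at hn
    simp [coeff_one, this]
  | insert a S ha ih =>
    rw [Finset.prod_insert ha]
    rw [Finset.filter_insert] at hn
    by_cases h : x a = 0
    · simp only [h, ne_eq, not_true_eq_false, if_false] at hn
      simpa [h] using ih n hn
    · rw [if_pos h, Finset.card_insert_of_notMem (by simp [ha])] at hn
      obtain ⟨n, rfl⟩ : ∃ m, n = m + 1 := ⟨n - 1, by omega⟩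
      rw [coeff_succ_one_sub_C_mul_X_mul, ih _ (by omega), ih _ (by omega)]
      simp

/-- The geometric series with ratio `c`. -/
noncomputable def geomSeries (c : ℝ) : PowerSeries ℝ := PowerSeries.mk fun n => c ^ n

theorem one_sub_mul_geomSeries (c : ℝ) : (1 - C c * X : PowerSeries ℝ) * geomSeries c = 1 := by
  ext n
  cases n with
  | zero => simp [geomSeries]
  | succ n =>
    rw [coeff_succ_one_sub_C_mul_X_mul]
    simp [geomSeries, coeff_one, pow_succ']

theorem sum_antidiagonal_pow_mul_pow_le {x y : ℝ} (hx : 0 ≤ x) (hy : 0 ≤ y) (n : ℕ) :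
    ∑ p ∈ Finset.HasAntidiagonal.antidiagonal n, x ^ p.1 * y ^ p.2 ≤ (x + y) ^ n := by
  rw [(Commute.all x y).add_pow']
  refine Finset.sum_le_sum fun p hp => ?_
  have h1 : 1 ≤ n.choose p.1 :=
    Nat.choose_pos (by have := Finset.HasAntidiagonal.mem_antidiagonal.1 hp; omega)
  rw [nsmul_eq_mul]
  refine le_mul_of_one_le_left (by positivity) (by exact_mod_cast h1)

/-- These are the complete homogeneous symmetric polynomials: each monomial appears once here and
with a multinomial coefficient at least 1 in the power of the sum. -/
theorem coeff_prod_geomSeries_mem (S : Finset ι) (x : ι → ℝ) (hx : ∀ a, 0 ≤ x a) (n : ℕ) :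
    0 ≤ coeff n (∏ a ∈ S, geomSeries (x a)) ∧
      coeff n (∏ a ∈ S, geomSeries (x a)) ≤ (∑ a ∈ S, x a) ^ n := by
  classical
  induction S using Finset.induction_on generalizing n with
  | empty => cases n <;> simp [coeff_one]
  | insert a S ha ih =>
    rw [Finset.prod_insert ha, Finset.sum_insert ha, coeff_mul]
    have hS : 0 ≤ ∑ a ∈ S, x a := Finset.sum_nonneg fun a _ => hx a
    constructor
    · refine Finset.sum_nonneg fun p _ => mul_nonneg ?_ (ih _).1
      simpa [geomSeries] using pow_nonneg (hx a) _
    · refine le_trans (Finset.sum_le_sum fun p _ => ?_)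
        (sum_antidiagonal_pow_mul_pow_le (hx a) hS n)
      simp only [geomSeries, coeff_mk]
      exact mul_le_mul_of_nonneg_left (ih _).2 (pow_nonneg (hx a) _)

theorem prod_one_sub_mul_prod_geomSeries (S : Finset ι) (x : ι → ℝ) :
    (∏ a ∈ S, (1 - C (x a) * X : PowerSeries ℝ)) * ∏ a ∈ S, geomSeries (x a) = 1 := by
  rw [← Finset.prod_mul_distrib]
  exact Finset.prod_eq_one fun a _ => one_sub_mul_geomSeries _

/-- The generating series `∑ₙ qₙ Xⁿ` over `n ≥ 1`. -/
noncomputable def positiveSeries (q : ℕ → ℝ) : PowerSeries ℝ := PowerSeries.mk fun n => if n = 0 then 0 else q n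

theorem positiveSeries_sum (S : Finset ι) (w x : ι → ℝ) :
    positiveSeries (fun n => ∑ a ∈ S, w a * x a ^ n) =
      ∑ a ∈ S, C (w a * x a) * (X * geomSeries (x a)) := by
  ext n
  cases n with
  | zero => simp [positiveSeries]
  | succ n =>
    simp only [positiveSeries, coeff_mk, map_sum, coeff_C_mul, coeff_succ_X_mul, geomSeries]
    simp only [Nat.add_eq_zero_iff, one_ne_zero, and_false, if_false]
    exact Finset.sum_congr rfl fun a _ => by ring

/-- Newton's identities as a logarithmic derivative: each factor contributes `-x a X / (1 - x a X)`.
-/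
theorem X_mul_derivative_prod_one_sub (S : Finset ι) (x : ι → ℝ) :
    X * derivative ℝ (∏ a ∈ S, (1 - C (x a) * X : PowerSeries ℝ)) =
      -((∏ a ∈ S, (1 - C (x a) * X : PowerSeries ℝ)) *
        positiveSeries fun n => ∑ a ∈ S, x a ^ n) := by
  classical
  have hsum : (positiveSeries fun n => ∑ a ∈ S, x a ^ n) =
      ∑ a ∈ S, C (x a) * (X * geomSeries (x a)) := by
    simpa using positiveSeries_sum S (fun _ => 1) x
  rw [hsum]
  clear hsum
  induction S using Finset.induction_on with
  | empty => simp
  | insert a S ha ih =>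
    rw [Finset.prod_insert ha, Finset.sum_insert ha, Derivation.leibniz]
    have h1 : derivative ℝ (1 - C (x a) * X : PowerSeries ℝ) = - C (x a) := by
      rw [map_sub, Derivation.leibniz]
      simp
    rw [h1, smul_eq_mul, smul_eq_mul]
    linear_combination (1 - C (x a) * X : PowerSeries ℝ) * ih +
      (X * C (x a) * ∏ a ∈ S, (1 - C (x a) * X : PowerSeries ℝ)) *
        one_sub_mul_geomSeries (x a)

/-- The series `∑ₘ (-1)ᵐ bₘ Xᵐ` of the outputs of the Newton-Girard recursion. -/
noncomputable def newtonGirardSeries (Q : ℕ → ℝ) : PowerSeries ℝ :=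
  PowerSeries.mk fun m => (-1) ^ m * newtonGirard Q m

/-- The recursion is, coefficient by coefficient, the differential equation satisfied by `∏ (1 - x a
X)`, but with arbitrary input in place of power sums. Exact and perturbed coefficients can therefore
be compared by dividing the series. -/
theorem X_mul_derivative_newtonGirardSeries (Q : ℕ → ℝ) :
    X * derivative ℝ (newtonGirardSeries Q) =
      -(newtonGirardSeries Q * positiveSeries Q) := by
  ext n
  cases n with
  | zero => simp [positiveSeries]
  | succ k =>
    rw [coeff_succ_X_mul, coeff_derivative, map_neg, mul_comm (newtonGirardSeries Q), coeff_mul,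
      Finset.Nat.sum_antidiagonal_eq_sum_range_succ_mk, Finset.sum_range_succ']
    simp only [newtonGirardSeries, positiveSeries, coeff_mk, Nat.add_eq_zero_iff, one_ne_zero,
      and_false, if_false, if_true, zero_mul, add_zero, Nat.add_sub_add_right]
    rw [newtonGirard, ← Fin.sum_univ_eq_sum_range
      (fun i => Q (i + 1) * ((-1) ^ (k - i) * newtonGirard Q (k - i))) (k + 1),
      mul_comm, ← mul_assoc, ← mul_assoc, mul_comm ((k : ℝ) + 1), mul_assoc ((-1 : ℝ) ^ (k + 1)),
      mul_one_div_cancel (by positivity), mul_one, Finset.mul_sum, ← Finset.sum_neg_distrib]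
    refine Finset.sum_congr rfl fun i _ => ?_
    have h : (-1 : ℝ) ^ (k + 1) * (-1) ^ (i : ℕ) = -(-1) ^ (k - (i : ℕ)) := by
      have hi : k + 1 = k - (i : ℕ) + i + 1 := by omega
      have hp : (-1 : ℝ) ^ (k + 1) = (-1) ^ (k - (i : ℕ)) * (-1) ^ (i : ℕ) * (-1) := by
        rw [← pow_add, ← pow_succ, ← hi]
      rw [hp]
      have : (-1 : ℝ) ^ (i : ℕ) * (-1) ^ (i : ℕ) = 1 := by
        rw [← mul_pow]; simp
      linear_combination (-(-1) ^ (k - (i : ℕ))) * this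
    linear_combination (newtonGirard Q (k - i) * Q (i + 1)) * h

theorem sum_range_one_div_factorial_le (n : ℕ) :
    ∑ i ∈ Finset.range n, (1 : ℝ) / i.factorial ≤ 3 := by
  have h := Real.sum_le_exp_of_nonneg (zero_le_one) n
  simp only [one_pow] at h
  exact h.trans (Real.exp_one_lt_d9.le.trans (by norm_num))

/-- The sum telescopes against `2 / i!`, because `2 / (i + 1)! ≤ 1 / i!` once `i ≥ 1`. -/
theorem sum_Ioc_one_div_factorial_pred_le {s : ℕ} (hs : 1 ≤ s) (n : ℕ) :
    ∑ i ∈ Finset.Ioc s n, (1 : ℝ) / (i - 1).factorial ≤ 2 / s.factorial := by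
  rcases le_total n s with h | h
  · rw [Finset.Ioc_eq_empty_of_le h]; simp; positivity
  suffices ∑ i ∈ Finset.Ioc s n, (1 : ℝ) / (i - 1).factorial ≤
      2 / s.factorial - 2 / n.factorial from this.trans (by
        have : (0 : ℝ) ≤ 2 / n.factorial := by positivity
        linarith)
  induction n, h using Nat.le_induction with
  | base => simp
  | succ n hn ih =>
    rw [← Finset.insert_Ioc_right_eq_Ioc_add_one hn, Finset.sum_insert (by simp)]
    have h1 : (2 : ℝ) / (n + 1).factorial ≤ 1 / n.factorial := by
      rw [Nat.factorial_succ]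
      push_cast
      rw [div_le_div_iff₀ (by positivity) (by positivity), one_mul]
      have : (1 : ℝ) ≤ n := by exact_mod_cast hs.trans hn
      gcongr
      linarith
    have h2 : (2 : ℝ) / n.factorial = 1 / n.factorial + 1 / n.factorial := by ring
    rw [Nat.add_sub_cancel]
    linarith

end Series

/-! ### Stability of the Newton-Girard recursion and tail estimates. -/

section Stability

open PowerSeries Finset.HasAntidiagonal

/-- The factor `n + 1` on the left equals the number of terms on the right, so `R (n + 1)` is, up to
sign, an average of products `R i * δ j`. Each is at most `η`, because `|R i| ≤ 1` by `η ≤ 1`; hence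
nothing accumulates. -/
theorem abs_le_of_convolution_recurrence {R δ : ℕ → ℝ} {η : ℝ} {s : ℕ} (hη1 : η ≤ 1)
    (h0 : R 0 = 1)
    (hδ : ∀ i, 1 ≤ i → i ≤ s → |δ i| ≤ η)
    (hR : ∀ n : ℕ, ((n : ℝ) + 1) * R (n + 1) = -∑ i ∈ Finset.range (n + 1), R i * δ (n + 1 - i))
    (m : ℕ) (hm : 1 ≤ m) (hms : m ≤ s) : |R m| ≤ η := by
  induction m using Nat.strong_induction_on with
  | _ m ih =>
    obtain ⟨n, rfl⟩ : ∃ n, m = n + 1 := ⟨m - 1, by omega⟩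
    have h1 : ((n : ℝ) + 1) * |R (n + 1)| ≤ ((n : ℝ) + 1) * η := by
      rw [← abs_of_nonneg (show (0 : ℝ) ≤ (n : ℝ) + 1 by positivity), ← abs_mul, hR, abs_neg,
        abs_of_nonneg (show (0 : ℝ) ≤ (n : ℝ) + 1 by positivity)]
      refine (Finset.abs_sum_le_sum_abs _ _).trans ?_
      have hc : ((n : ℝ) + 1) * η = ∑ i ∈ Finset.range (n + 1), η := by simp
      rw [hc]
      refine Finset.sum_le_sum fun i hi => ?_
      rw [Finset.mem_range] at hi
      rw [abs_mul]
      have hd := hδ (n + 1 - i) (by omega) (by omega)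
      rcases Nat.eq_zero_or_pos i with rfl | hi0
      · simpa [h0] using hd
      · have := ih i (by omega) hi0 (by omega)
        calc |R i| * |δ (n + 1 - i)| ≤ 1 * η :=
              mul_le_mul (this.trans hη1) hd (abs_nonneg _) zero_le_one
          _ = η := one_mul _
    exact le_of_mul_le_mul_left h1 (by positivity)

/-- Discrete Gronwall inequality. -/
theorem le_mul_one_add_pow_of_le_add_sum {f : ℕ → ℝ} {B τ : ℝ} {N : ℕ} (hτ : 0 ≤ τ)
    (h : ∀ n ≤ N, f n ≤ B + τ * ∑ j ∈ Finset.range n, f j) (n : ℕ) (hn : n ≤ N) :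
    f n ≤ B * (1 + τ) ^ n := by
  induction n using Nat.strong_induction_on with
  | _ n ih =>
    have h1 : ∑ j ∈ Finset.range n, f j ≤ ∑ j ∈ Finset.range n, B * (1 + τ) ^ j :=
      Finset.sum_le_sum fun j hj => ih j (Finset.mem_range.1 hj)
        ((Finset.mem_range.1 hj).le.trans hn)
    have h2 := mul_geom_sum (1 + τ) n
    rw [add_sub_cancel_left] at h2
    have h3 := mul_le_mul_of_nonneg_left h1 hτ
    rw [← Finset.mul_sum] at h3
    have h4 := h n hn
    have h5 : τ * (B * ∑ j ∈ Finset.range n, (1 + τ) ^ j) = B * ((1 + τ) ^ n - 1) := by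
      rw [← h2]; ring
    linarith

theorem abs_coeff_mul_le_sum_left {f g : PowerSeries ℝ} {M : ℝ} {n : ℕ}
    (hg : ∀ i ≤ n, |coeff i g| ≤ M) :
    |coeff n (f * g)| ≤ (∑ i ∈ Finset.range (n + 1), |coeff i f|) * M := by
  rw [coeff_mul, Finset.Nat.sum_antidiagonal_eq_sum_range_succ_mk, Finset.sum_mul]
  refine (Finset.abs_sum_le_sum_abs _ _).trans (Finset.sum_le_sum fun i _ => ?_)
  rw [abs_mul]
  exact mul_le_mul_of_nonneg_left (hg _ (Nat.sub_le _ _)) (abs_nonneg _)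

/-- The quotient of the perturbed series by the exact one is within `η` of 1 in every coefficient up
to `s`. Multiplying back by the exact series costs only its ℓ¹ norm, at most `∑ 1 / i! ≤ 3`. -/
theorem abs_newtonGirardSeries_sub_le {ι : Type*} [Fintype ι] {x : ι → ℝ} (hx : ∀ a, 0 ≤ x a)
    (hx1 : ∑ a, x a = 1) {Q : ℕ → ℝ} {η : ℝ} {s : ℕ} (hη : 0 ≤ η) (hη1 : η ≤ 1)
    (hQ : ∀ i, 1 ≤ i → i ≤ s → |Q i - ∑ a, x a ^ i| ≤ η) (m : ℕ) (hms : m ≤ s) :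
    |coeff m (newtonGirardSeries Q - ∏ a, (1 - C (x a) * X : PowerSeries ℝ))| ≤ 3 * η := by
  set A : PowerSeries ℝ := ∏ a, (1 - C (x a) * X : PowerSeries ℝ) with hA
  set H : PowerSeries ℝ := ∏ a, geomSeries (x a) with hH
  set B := newtonGirardSeries Q
  set P := positiveSeries fun n => ∑ a, x a ^ n with hP
  have hAH : A * H = 1 := prod_one_sub_mul_prod_geomSeries _ _
  have hA' : X * derivative ℝ A = -(A * P) := X_mul_derivative_prod_one_sub _ _
  have hB' : X * derivative ℝ B = -(B * positiveSeries Q) :=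
    X_mul_derivative_newtonGirardSeries Q
  -- In the logarithmic derivative of `B / A` the two differential equations subtract, leaving only
  -- the error of the power sums.
  have hR' : X * derivative ℝ (B * H) = -((B * H) * (positiveSeries Q - P)) := by
    have h1 : A * derivative ℝ H + H * derivative ℝ A = 0 := by
      have := congrArg (derivative ℝ) hAH
      rw [Derivation.leibniz] at this
      simpa using this
    rw [Derivation.leibniz, smul_eq_mul, smul_eq_mul]
    linear_combination H * hB' - B * H * H * hA' + X * B * H * h1 -
      (X * B * derivative ℝ H - B * H * P) * hAH
  have hdiff : B - A = (B * H - 1) * A := by linear_combination (-B) * hAH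
  have hB0 : coeff 0 (B * H) = 1 := by
    have h0 : coeff 0 B = 1 := by simp [B, newtonGirardSeries, newtonGirard]
    have h1 : coeff 0 H = 1 := by
      rw [hH, coeff_zero_eq_constantCoeff, map_prod]
      refine Finset.prod_eq_one fun a _ => ?_
      simp [← coeff_zero_eq_constantCoeff_apply, geomSeries]
    simp only [coeff_zero_eq_constantCoeff, map_mul] at h0 h1 ⊢
    rw [h0, h1, mul_one]
  have hRbound : ∀ i, 1 ≤ i → i ≤ s → |coeff i (B * H)| ≤ η := by
    refine abs_le_of_convolution_recurrence (δ := fun i => coeff i (positiveSeries Q - P))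
      hη1 hB0 ?_ ?_
    · intro i hi his
      have : i ≠ 0 := by omega
      simpa [positiveSeries, hP, this] using hQ i hi his
    · intro n
      clear hdiff hB0
      generalize B * H = R at hR' ⊢
      have := congrArg (coeff (n + 1)) hR'
      rw [coeff_succ_X_mul, coeff_derivative, map_neg, coeff_mul,
        Finset.Nat.sum_antidiagonal_eq_sum_range_succ_mk, Finset.sum_range_succ] at this
      rw [mul_comm, this]
      simp [positiveSeries, hP]
  rw [hdiff, mul_comm]
  refine (abs_coeff_mul_le_sum_left (M := η) fun i hi => ?_).trans ?_
  · rcases Nat.eq_zero_or_pos i with rfl | hi0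
    · rw [map_sub, hB0]; simpa using hη
    · simpa [coeff_one, hi0.ne'] using hRbound i hi0 (hi.trans hms)
  · refine mul_le_mul_of_nonneg_right ?_ hη
    refine le_trans (Finset.sum_le_sum fun i _ => ?_) (sum_range_one_div_factorial_le (m + 1))
    simpa [hx1] using abs_coeff_prod_one_sub_le Finset.univ x hx i


/-- The series is `∑ w a x a X / (1 - x a X)`, and multiplying by the full product cancels one
factor in each summand. The result is a polynomial, whose degree and coefficient size are read off
below. -/
theorem coeff_succ_prod_one_sub_mul_positiveSeries {ι : Type*} [Fintype ι] [DecidableEq ι]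
    (w x : ι → ℝ) (n : ℕ) :
    coeff (n + 1) ((∏ a, (1 - C (x a) * X : PowerSeries ℝ)) *
      positiveSeries fun n => ∑ a, w a * x a ^ n) =
      ∑ a, w a * x a *
        coeff n (∏ b ∈ Finset.univ.erase a, (1 - C (x b) * X : PowerSeries ℝ)) := by
  rw [positiveSeries_sum, Finset.mul_sum, map_sum]
  refine Finset.sum_congr rfl fun a _ => ?_
  rw [← Finset.mul_prod_erase _ _ (Finset.mem_univ a), ← coeff_succ_X_mul n, ← coeff_C_mul]
  congr 1
  linear_combination (C (w a * x a) * X *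
    ∏ b ∈ Finset.univ.erase a, (1 - C (x b) * X : PowerSeries ℝ)) * one_sub_mul_geomSeries (x a)

theorem abs_coeff_prod_one_sub_mul_positiveSeries_le {ι : Type*} [Fintype ι]
    {w x : ι → ℝ} (hx : ∀ a, 0 ≤ x a) (hx1 : ∑ a, x a = 1) (hw : ∀ a, 0 ≤ w a)
    (hw1 : ∀ a, w a ≤ 1) {n : ℕ} (hn : 1 ≤ n) :
    |coeff n ((∏ a, (1 - C (x a) * X : PowerSeries ℝ)) *
      positiveSeries fun n => ∑ a, w a * x a ^ n)| ≤ 1 / (n - 1).factorial := by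
  classical
  obtain ⟨n, rfl⟩ : ∃ m, n = m + 1 := ⟨n - 1, by omega⟩
  rw [coeff_succ_prod_one_sub_mul_positiveSeries, Nat.add_sub_cancel]
  calc _ ≤ ∑ a, x a * (1 / n.factorial) := by
        refine (Finset.abs_sum_le_sum_abs _ _).trans (Finset.sum_le_sum fun a _ => ?_)
        rw [abs_mul, abs_of_nonneg (mul_nonneg (hw a) (hx a))]
        refine mul_le_mul (mul_le_of_le_one_left (hx a) (hw1 a)) ?_ (abs_nonneg _) (hx a)
        refine (abs_coeff_prod_one_sub_le _ x hx n).trans ?_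
        refine div_le_div_of_nonneg_right ?_ (by positivity)
        refine pow_le_one₀ (Finset.sum_nonneg fun a _ => hx a) ?_
        rw [← hx1]
        exact Finset.sum_le_sum_of_subset_of_nonneg (Finset.subset_univ _) fun a _ _ => hx a
    _ = 1 / n.factorial := by rw [← Finset.sum_mul, hx1, one_mul]

theorem coeff_prod_one_sub_mul_positiveSeries_eq_zero {ι : Type*} [Fintype ι] (w x : ι → ℝ)
    {n : ℕ} (hn : (Finset.univ.filter fun a => x a ≠ 0).card < n) :
    coeff n ((∏ a, (1 - C (x a) * X : PowerSeries ℝ)) *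
      positiveSeries fun n => ∑ a, w a * x a ^ n) = 0 := by
  classical
  obtain ⟨n, rfl⟩ : ∃ m, n = m + 1 := ⟨n - 1, by omega⟩
  rw [coeff_succ_prod_one_sub_mul_positiveSeries]
  refine Finset.sum_eq_zero fun a _ => ?_
  by_cases ha : x a = 0
  · simp [ha]
  -- Removing a factor with `x a ≠ 0` lowers the degree by one, which makes up for the shift by `X`.
  · rw [coeff_prod_one_sub_eq_zero, mul_zero]
    rw [Finset.filter_erase, Finset.card_erase_of_mem (by simpa using ha)]
    have : 0 < (Finset.univ.filter fun a => x a ≠ 0).card :=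
      Finset.card_pos.2 ⟨a, by simpa using ha⟩
    omega

/-- Here the two regimes of the cutoff are merged: either it reaches the degree `r` and the tail is
zero, or it is so large that factorial decay suffices. -/
theorem sum_Ioc_abs_le_of_factorial_decay {f : ℕ → ℝ} {θ : ℝ} {r s : ℕ} (hs : 1 ≤ s) (hθ : 0 ≤ θ)
    (htail : r ≤ s ∨ (2 : ℝ) / s.factorial ≤ θ)
    (hf : ∀ i, 1 ≤ i → |f i| ≤ 1 / (i - 1).factorial) (hf0 : ∀ i, r < i → f i = 0) (n : ℕ) :
    ∑ i ∈ Finset.Ioc s n, |f i| ≤ θ := by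
  rcases htail with h | h
  · rw [Finset.sum_eq_zero]
    · exact hθ
    · intro i hi
      rw [Finset.mem_Ioc] at hi
      rw [hf0 i (by omega), abs_zero]
  · refine le_trans (Finset.sum_le_sum fun i hi => ?_)
      ((sum_Ioc_one_div_factorial_pred_le hs n).trans h)
    rw [Finset.mem_Ioc] at hi
    exact hf i (by omega)

theorem sum_range_le_of_le_ite {f g : ℕ → ℝ} {T : Finset ℕ} (hg : ∀ i ∈ T, 0 ≤ g i) (n : ℕ)
    (h : ∀ i ∈ Finset.range n, f i ≤ if i ∈ T then g i else 0) :
    ∑ i ∈ Finset.range n, f i ≤ ∑ i ∈ T, g i := by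
  refine (Finset.sum_le_sum h).trans ?_
  rw [Finset.sum_ite_mem]
  exact Finset.sum_le_sum_of_subset_of_nonneg Finset.inter_subset_right fun i hi _ => hg i hi

/-- The recurrence defining `extend` expresses the vanishing of these coefficients when `b 0 = 1`,
as is the case for `newtonGirard`. -/
theorem coeff_trunc_mul_positiveSeries_extend (s : ℕ) (b q : ℕ → ℝ) {n : ℕ} (hn : s < n) :
    coeff n ((PowerSeries.mk fun m => if m ≤ s then (-1) ^ m * b m else 0) *
      positiveSeries (extend s b q)) = (b 0 - 1) * extend s b q n := by
  rw [coeff_mul, Finset.Nat.sum_antidiagonal_eq_sum_range_succ_mk,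
    ← Finset.sum_range_add_sum_Ico _ (show s + 1 ≤ n + 1 by omega),
    Finset.sum_eq_zero (s := Finset.Ico (s + 1) (n + 1)), add_zero, Finset.sum_range_succ']
  · have hrec : extend s b q n =
        ∑ m ∈ Finset.range s, (-1) ^ m * b (m + 1) * extend s b q (n - (m + 1)) := by
      rw [extend, if_neg (by omega), ← Fin.sum_univ_eq_sum_range
        (fun m => (-1 : ℝ) ^ m * b (m + 1) * extend s b q (n - (m + 1)))]
    have : ∑ m ∈ Finset.range s,
        coeff (m + 1) (PowerSeries.mk fun m => if m ≤ s then (-1) ^ m * b m else 0) *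
          coeff (n - (m + 1)) (positiveSeries (extend s b q)) = - extend s b q n := by
      rw [hrec, ← Finset.sum_neg_distrib]
      refine Finset.sum_congr rfl fun m hm => ?_
      rw [Finset.mem_range] at hm
      have h1 : m + 1 ≤ s := by omega
      have h2 : n - (m + 1) ≠ 0 := by omega
      simp only [positiveSeries, coeff_mk, h1, h2, if_true, if_false]
      ring
    have h2 : n ≠ 0 := by omega
    rw [this]
    simp [positiveSeries, h2]
    ring
  · intro m hm
    rw [Finset.mem_Ico] at hm
    have h1 : ¬ m ≤ s := by omega
    simp [h1]

end Stability

/-! ### Error of one continuation. -/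

section ExtendError

open PowerSeries

/-- Forward error of the linear recurrence whose coefficients come from perturbed power sums of a
probability vector `x`. The error grows linearly in the index, not exponentially in `s`. -/
theorem abs_extend_newtonGirard_sub_le {ι : Type*} [Fintype ι] {w x : ι → ℝ} (hx : ∀ a, 0 ≤ x a)
    (hx1 : ∑ a, x a = 1) (hw : ∀ a, 0 ≤ w a) (hw1 : ∀ a, w a ≤ 1) {Q q : ℕ → ℝ}
    {η κ θ : ℝ} {s N : ℕ} (hs : 1 ≤ s) (hη : 0 ≤ η) (hη1 : η ≤ 1) (hκ : 0 ≤ κ) (hθ : 0 ≤ θ)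
    (htail : (Finset.univ.filter fun a => x a ≠ 0).card ≤ s ∨ (2 : ℝ) / s.factorial ≤ θ)
    (hQ : ∀ i, 1 ≤ i → i ≤ s → |Q i - ∑ a, x a ^ i| ≤ η)
    (hq : ∀ i, 1 ≤ i → i ≤ s → |q i - ∑ a, w a * x a ^ i| ≤ κ)
    (hN : N * (3 * η * s + θ) ≤ 1) (n : ℕ) (hn1 : 1 ≤ n) (hn : n ≤ N) :
    |extend s (newtonGirard Q) q n - ∑ a, w a * x a ^ n| ≤
      12 * s * κ + 9 * N * s * η + 6 * N * θ := by
  have hN1 : (1 : ℝ) ≤ N := by exact_mod_cast hn1.trans hn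
  set τ : ℝ := 3 * η * s + θ with hτdef
  have hτ : 0 ≤ τ := by positivity
  have hτ1 : τ ≤ 1 := by nlinarith
  set A : PowerSeries ℝ := ∏ a, (1 - C (x a) * X : PowerSeries ℝ) with hA
  set H : PowerSeries ℝ := ∏ a, geomSeries (x a) with hH
  set D : PowerSeries ℝ :=
    PowerSeries.mk fun m => if m ≤ s then (-1) ^ m * newtonGirard Q m else 0 with hD
  set G : PowerSeries ℝ := positiveSeries fun n => ∑ a, w a * x a ^ n with hG
  set Ĝ : PowerSeries ℝ := positiveSeries (extend s (newtonGirard Q) q) with hGh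
  have hAH : A * H = 1 := prod_one_sub_mul_prod_geomSeries _ _
  have hHb : ∀ i, |coeff i H| ≤ 1 := fun i => by
    have := coeff_prod_geomSeries_mem Finset.univ x hx i
    rw [hx1, one_pow] at this
    rw [abs_of_nonneg this.1]
    exact this.2
  have hAb : ∀ i, |coeff i A| ≤ 1 / i.factorial := fun i => by
    simpa [hx1] using abs_coeff_prod_one_sub_le Finset.univ x hx i
  -- Weakened so that one tail estimate serves both `A` and `A * G`.
  have hAb' : ∀ i, |coeff i A| ≤ 1 / (i - 1).factorial := fun i => by
    refine (hAb i).trans (one_div_le_one_div_of_le (by positivity) ?_)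
    exact_mod_cast Nat.factorial_le (Nat.sub_le i 1)
  have hGb : ∀ i, |coeff i G| ≤ 1 := fun i => by
    rcases Nat.eq_zero_or_pos i with rfl | hi
    · simp [hG, positiveSeries]
    · have : coeff i G = ∑ a, w a * x a ^ i := by simp [hG, positiveSeries, hi.ne']
      rw [this, abs_of_nonneg (Finset.sum_nonneg fun a _ => mul_nonneg (hw a) (pow_nonneg (hx a) _)),
        ← hx1]
      refine Finset.sum_le_sum fun a _ => ?_
      have hxa : x a ≤ 1 := by
        rw [← hx1]; exact Finset.single_le_sum (fun a _ => hx a) (Finset.mem_univ a)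
      exact (mul_le_of_le_one_left (pow_nonneg (hx a) _) (hw1 a)).trans
        (pow_le_of_le_one (hx a) hxa hi.ne')
  have hΔ : ∀ n, ∑ i ∈ Finset.range (n + 1), |coeff i (D - A)| ≤ τ := fun n => by
    have hpt : ∀ i ∈ Finset.range (n + 1), |coeff i (D - A)| ≤
        (if i ∈ Finset.Icc 1 s then 3 * η else 0) +
          (if i ∈ Finset.Ioc s n then |coeff i A| else 0) := fun i hi => by
      rw [Finset.mem_range] at hi
      simp only [Finset.mem_Icc, Finset.mem_Ioc]
      by_cases his : i ≤ s
      · rw [if_neg (c := s < i ∧ i ≤ n) (by omega), add_zero]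
        have hc : coeff i (D - A) = coeff i (newtonGirardSeries Q - A) := by
          simp [hD, newtonGirardSeries, his]
        rw [hc]
        by_cases h1 : 1 ≤ i
        · rw [if_pos ⟨h1, his⟩]
          exact abs_newtonGirardSeries_sub_le hx hx1 hη hη1 hQ i his
        · obtain rfl : i = 0 := by omega
          simp [newtonGirardSeries, newtonGirard, hA, map_prod]
      · rw [if_neg (by omega), if_pos (by omega), zero_add]
        simp [hD, his]
    refine (Finset.sum_le_sum hpt).trans ?_
    rw [Finset.sum_add_distrib]
    refine add_le_add ?_ ?_
    · refine (sum_range_le_of_le_ite (g := fun _ => 3 * η) (fun i _ => by positivity) (n + 1)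
        fun i _ => le_rfl).trans ?_
      simp
      linarith
    · refine (sum_range_le_of_le_ite (g := fun i => |coeff i A|) (fun i _ => abs_nonneg _) (n + 1)
        fun i _ => le_rfl).trans ?_
      exact sum_Ioc_abs_le_of_factorial_decay hs hθ htail (fun i _ => hAb' i)
        (fun i hi => coeff_prod_one_sub_eq_zero _ x i hi) n
  have hDb : ∀ n, ∑ i ∈ Finset.range (n + 1), |coeff i D| ≤ 4 := fun n => by
    have : ∀ i ∈ Finset.range (n + 1), |coeff i D| ≤ |coeff i (D - A)| + 1 / i.factorial :=
      fun i _ => by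
        have h1 : coeff i D = coeff i (D - A) + coeff i A := by simp
        rw [h1]
        exact (abs_add_le _ _).trans (add_le_add le_rfl (hAb i))
    refine (Finset.sum_le_sum this).trans ?_
    rw [Finset.sum_add_distrib]
    linarith [hΔ n, sum_range_one_div_factorial_le (n + 1)]
  set F := Ĝ - G with hF
  set S := D * F with hS
  -- Write `D = A + (D - A)` in `S = D * F` and multiply by `H = 1 / A`.
  have hFeq : F = S * H - F * ((D - A) * H) := by
    linear_combination (-F) * hAH
  have hF0 : coeff 0 F = 0 := by simp [hF, hG, hGh, positiveSeries]
  have hSpt : ∀ n, n ≤ N → ∀ i ∈ Finset.range (n + 1), |coeff i S| ≤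
      (if i ∈ Finset.Icc 1 s then 4 * κ else 0) +
        ((if i ∈ Finset.Ioc s n then |coeff i (A * G)| else 0) +
          (if i ∈ Finset.Icc 1 N then τ else 0)) := fun n hn i hi => by
    rw [Finset.mem_range] at hi
    simp only [Finset.mem_Icc, Finset.mem_Ioc]
    rcases Nat.eq_zero_or_pos i with rfl | hi0
    · rw [hS]
      simp only [coeff_zero_eq_constantCoeff, map_mul] at hF0 ⊢
      rw [hF0]
      simp
    by_cases his : i ≤ s
    · rw [if_pos ⟨hi0, his⟩, if_neg (by omega), if_pos (by omega), zero_add]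
      refine le_trans ?_ (le_add_of_nonneg_right hτ)
      refine (abs_coeff_mul_le_sum_left (M := κ) fun j hj => ?_).trans
        (mul_le_mul_of_nonneg_right (hDb i) hκ)
      rcases Nat.eq_zero_or_pos j with rfl | hj0
      · rw [hF0]; simpa using hκ
      · have hjs : j ≤ s := hj.trans his
        have : coeff j F = q j - ∑ a, w a * x a ^ j := by
          simp [hF, hG, hGh, positiveSeries, hj0.ne']
          rw [extend, if_pos hjs]
        rw [this]
        exact hq j hj0 hjs
    · rw [if_neg (by omega), if_pos (by omega), if_pos (by omega), zero_add]
      have h0 : coeff i (D * Ĝ) = 0 := by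
        rw [hD, hGh, coeff_trunc_mul_positiveSeries_extend s _ q (by omega)]
        simp [newtonGirard]
      -- Beyond degree `s` the first term vanishes by the recurrence, the second is the tail of a
      -- polynomial, and the third is the coefficient error.
      have h1 : S = D * Ĝ - A * G - (D - A) * G := by rw [hS, hF]; ring
      rw [h1, map_sub, map_sub, h0, zero_sub]
      refine (abs_sub _ _).trans ?_
      rw [abs_neg]
      refine add_le_add le_rfl ?_
      refine (abs_coeff_mul_le_sum_left (M := 1) fun j _ => hGb j).trans ?_
      rw [mul_one]
      exact hΔ i
  have hSb : ∀ n ≤ N, ∑ i ∈ Finset.range (n + 1), |coeff i S| ≤ 4 * s * κ + θ + N * τ := by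
    intro n hn
    refine (Finset.sum_le_sum (hSpt n hn)).trans ?_
    rw [Finset.sum_add_distrib, Finset.sum_add_distrib, add_assoc]
    refine add_le_add ?_ (add_le_add ?_ ?_)
    · refine (sum_range_le_of_le_ite (g := fun _ => 4 * κ) (fun i _ => by positivity) (n + 1)
        fun i _ => le_rfl).trans ?_
      simp
      linarith
    · refine (sum_range_le_of_le_ite (g := fun i => |coeff i (A * G)|) (fun i _ => abs_nonneg _)
        (n + 1) fun i _ => le_rfl).trans ?_
      exact sum_Ioc_abs_le_of_factorial_decay hs hθ htail
        (fun i hi => abs_coeff_prod_one_sub_mul_positiveSeries_le hx hx1 hw hw1 hi)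
        (fun i hi => coeff_prod_one_sub_mul_positiveSeries_eq_zero w x hi) n
    · refine (sum_range_le_of_le_ite (g := fun _ => τ) (fun i _ => hτ) (n + 1)
        fun i _ => le_rfl).trans ?_
      simp
  -- Without a constant term, the convolution of this series with `F` involves only strictly earlier
  -- coefficients of `F`, as Gronwall requires.
  have hK0 : coeff 0 ((D - A) * H) = 0 := by
    have h1 : coeff 0 (D - A) = 0 := by
      simp [hD, newtonGirard, hA, map_prod]
    simp only [coeff_zero_eq_constantCoeff, map_mul] at h1 ⊢
    rw [h1, zero_mul]
  have hK : ∀ i, |coeff i ((D - A) * H)| ≤ τ := fun i => by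
    refine (abs_coeff_mul_le_sum_left (M := 1) fun j _ => hHb j).trans ?_
    rw [mul_one]
    exact hΔ i
  have hrec : ∀ n ≤ N, |coeff n F| ≤
      (4 * s * κ + θ + N * τ) + τ * ∑ j ∈ Finset.range n, |coeff j F| := fun n hn => by
    have h1 : |coeff n (S * H)| ≤ 4 * s * κ + θ + N * τ := by
      refine (abs_coeff_mul_le_sum_left (M := 1) fun j _ => hHb j).trans ?_
      rw [mul_one]
      exact hSb n hn
    have h2 : |coeff n (F * ((D - A) * H))| ≤ τ * ∑ j ∈ Finset.range n, |coeff j F| := by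
      rw [coeff_mul, Finset.Nat.sum_antidiagonal_eq_sum_range_succ_mk, Finset.sum_range_succ,
        Nat.sub_self, hK0, mul_zero, add_zero, Finset.mul_sum]
      refine (Finset.abs_sum_le_sum_abs _ _).trans (Finset.sum_le_sum fun i _ => ?_)
      rw [abs_mul, mul_comm]
      exact mul_le_mul_of_nonneg_right (hK _) (abs_nonneg _)
    rw [hFeq, map_sub, ← hFeq]
    exact (abs_sub _ _).trans (add_le_add h1 h2)
  have hfin := le_mul_one_add_pow_of_le_add_sum hτ hrec n hn
  -- This is where `N * τ ≤ 1` rules out exponential growth: the Gronwall factor is at most `e`.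
  have hpow : (1 + τ) ^ n ≤ 3 := by
    calc (1 + τ) ^ n ≤ (Real.exp τ) ^ n := by
          gcongr
          rw [add_comm]
          exact Real.add_one_le_exp τ
      _ = Real.exp (n * τ) := (Real.exp_nat_mul τ n).symm
      _ ≤ Real.exp 1 := by
          refine Real.exp_le_exp.2 (le_trans ?_ hN)
          gcongr
      _ ≤ 3 := Real.exp_one_lt_d9.le.trans (by norm_num)
  have hcF : coeff n F = extend s (newtonGirard Q) q n - ∑ a, w a * x a ^ n := by
    have : n ≠ 0 := by omega
    simp [hF, hG, hGh, positiveSeries, this]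
  rw [← hcF]
  refine hfin.trans ((mul_le_mul_of_nonneg_left hpow (by positivity)).trans ?_)
  have : θ ≤ N * θ := le_mul_of_one_le_left hθ hN1
  rw [hτdef]
  linarith

end ExtendError

/-! ### Moments of two states as mixed moments of their spectra. -/

section Spectral

variable {d : ℕ}

theorem Matrix.IsHermitian.pow_eq_eigenvectorUnitary_mul {ρ : Matrix (Fin d) (Fin d) ℂ}
    (hρ : ρ.IsHermitian) (i : ℕ) :
    ρ ^ i = (hρ.eigenvectorUnitary : Matrix (Fin d) (Fin d) ℂ) *
      Matrix.diagonal (fun a => ((hρ.eigenvalues a : ℂ)) ^ i) *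
        (hρ.eigenvectorUnitary : Matrix (Fin d) (Fin d) ℂ)ᴴ := by
  conv_lhs => rw [hρ.spectral_theorem, ← map_pow, Matrix.diagonal_pow,
    Unitary.conjStarAlgAut_apply]
  rfl

theorem trace_diagonal_mul_mul_diagonal_mul (x y : Fin d → ℂ) (W : Matrix (Fin d) (Fin d) ℂ) :
    (Matrix.diagonal x * W * Matrix.diagonal y * Wᴴ).trace =
      ∑ a, ∑ b, (Complex.normSq (W a b) : ℂ) * x a * y b := by
  simp only [Matrix.trace, Matrix.diag_apply, Matrix.mul_apply (N := Wᴴ), Matrix.mul_diagonal,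
    Matrix.diagonal_mul, Matrix.conjTranspose_apply]
  refine Finset.sum_congr rfl fun a _ => Finset.sum_congr rfl fun b _ => ?_
  rw [Complex.normSq_eq_conj_mul_self]
  simp only [RCLike.star_def]
  ring

theorem sum_normSq_row_eq_one {W : Matrix (Fin d) (Fin d) ℂ} (hW : W * Wᴴ = 1) (a : Fin d) :
    ∑ b, Complex.normSq (W a b) = 1 := by
  have h := congrFun (congrFun hW a) a
  rw [Matrix.mul_apply, Matrix.one_apply_eq] at h
  have h2 : ((∑ b, Complex.normSq (W a b) : ℝ) : ℂ) = 1 := by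
    rw [← h]
    push_cast
    refine Finset.sum_congr rfl fun b _ => ?_
    rw [Complex.normSq_eq_conj_mul_self, Matrix.conjTranspose_apply, mul_comm]
    rfl
  exact_mod_cast h2

theorem IsDensityMatrix.sum_eigenvalues {ρ : Matrix (Fin d) (Fin d) ℂ} (hρ : IsDensityMatrix ρ) :
    ∑ a, hρ.1.isHermitian.eigenvalues a = 1 := by
  have h := hρ.1.isHermitian.trace_eq_sum_eigenvalues.symm.trans hρ.2
  have h2 : ((∑ a, hρ.1.isHermitian.eigenvalues a : ℝ) : ℂ) = 1 := by
    refine Eq.trans ?_ h; push_cast; rfl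
  exact_mod_cast h2

theorem Matrix.IsHermitian.card_filter_eigenvalues_ne_zero {ρ : Matrix (Fin d) (Fin d) ℂ}
    (hρ : ρ.IsHermitian) :
    (Finset.univ.filter fun a => hρ.eigenvalues a ≠ 0).card = ρ.rank := by
  rw [hρ.rank_eq_card_non_zero_eigs, Fintype.card_subtype]

/-- Moments `Tr(ρ^i σ^j)` of two states are the mixed moments of their spectra with respect to the
doubly stochastic matrix of squared overlaps of the eigenbases. -/
theorem exists_doublyStochastic_trace_eq {ρ σ : Matrix (Fin d) (Fin d) ℂ}
    (hρ : ρ.IsHermitian) (hσ : σ.IsHermitian) :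
    ∃ p : Fin d → Fin d → ℝ, (∀ a b, 0 ≤ p a b) ∧ (∀ a, ∑ b, p a b = 1) ∧
      (∀ b, ∑ a, p a b = 1) ∧ ∀ i j : ℕ, (ρ ^ i * σ ^ j).trace =
        ((∑ a, ∑ b, p a b * hρ.eigenvalues a ^ i * hσ.eigenvalues b ^ j : ℝ) : ℂ) := by
  set U : Matrix (Fin d) (Fin d) ℂ := hρ.eigenvectorUnitary.1 with hU
  set V : Matrix (Fin d) (Fin d) ℂ := hσ.eigenvectorUnitary.1 with hV
  have hUU : U * Uᴴ = 1 := Unitary.mul_star_self_of_mem hρ.eigenvectorUnitary.2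
  have hUU' : Uᴴ * U = 1 := Unitary.star_mul_self_of_mem hρ.eigenvectorUnitary.2
  have hVV : V * Vᴴ = 1 := Unitary.mul_star_self_of_mem hσ.eigenvectorUnitary.2
  have hVV' : Vᴴ * V = 1 := Unitary.star_mul_self_of_mem hσ.eigenvectorUnitary.2
  have hW : (Uᴴ * V) * (Uᴴ * V)ᴴ = 1 := by
    rw [Matrix.conjTranspose_mul, Matrix.conjTranspose_conjTranspose, Matrix.mul_assoc,
      ← Matrix.mul_assoc V, hVV, Matrix.one_mul, hUU']
  have hW' : (Uᴴ * V)ᴴ * (Uᴴ * V) = 1 := mul_eq_one_comm.1 hW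
  refine ⟨fun a b => Complex.normSq ((Uᴴ * V) a b), fun a b => Complex.normSq_nonneg _,
    sum_normSq_row_eq_one hW, fun b => ?_, fun i j => ?_⟩
  · have h := sum_normSq_row_eq_one (W := (Uᴴ * V)ᴴ)
      (by rw [Matrix.conjTranspose_conjTranspose]; exact hW') b
    simpa only [Matrix.conjTranspose_apply (Uᴴ * V), RCLike.star_def, Complex.normSq_conj] using h
  · have h := trace_diagonal_mul_mul_diagonal_mul (fun a => (hρ.eigenvalues a : ℂ) ^ i)
      (fun b => (hσ.eigenvalues b : ℂ) ^ j) (Uᴴ * V)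
    rw [hρ.pow_eq_eigenvectorUnitary_mul, hσ.pow_eq_eigenvectorUnitary_mul]
    push_cast
    rw [← h, Matrix.conjTranspose_mul, Matrix.conjTranspose_conjTranspose, ← hU, ← hV]
    rw [Matrix.mul_assoc U, Matrix.mul_assoc U, Matrix.trace_mul_comm U]
    simp only [Matrix.mul_assoc]

end Spectral

/-! ### Traces of products as sums over closed paths. -/

section CyclicTrace

theorem prod_ofFn_apply_eq_sum_paths {d : ℕ} (n : ℕ)
    (M : Fin (n + 1) → Matrix (Fin d) (Fin d) ℂ) (a b : Fin d) :
    (List.ofFn M).prod a b = ∑ v : Fin n → Fin d, ∏ r : Fin (n + 1),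
      M r (Fin.cons (α := fun _ => Fin d) a v r) (Fin.snoc (α := fun _ => Fin d) v b r) := by
  induction n generalizing a with
  | zero =>
    simp [List.ofFn_succ, Fin.snoc]
  | succ n ih =>
    rw [List.ofFn_succ, List.prod_cons, Matrix.mul_apply,
      ← (Fin.consEquiv fun _ : Fin (n + 1) => Fin d).sum_comp, Fintype.sum_prod_type]
    refine Finset.sum_congr rfl fun c _ => ?_
    rw [ih, Finset.mul_sum]
    refine Finset.sum_congr rfl fun v _ => ?_
    change _ = ∏ r, M r
      (Fin.cons (α := fun _ => Fin d) a (Fin.cons (α := fun _ => Fin d) c v) r)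
      (Fin.snoc (α := fun _ => Fin d) (Fin.cons (α := fun _ => Fin d) c v) b r)
    rw [Fin.prod_univ_succ (n := n + 1), ← Fin.cons_snoc_eq_snoc_cons]
    simp only [Fin.cons_zero, Fin.cons_succ]

theorem trace_prod_ofFn_eq_sum_cycle {d n : ℕ}
    (M : Fin (n + 1) → Matrix (Fin d) (Fin d) ℂ) :
    (List.ofFn M).prod.trace = ∑ u : Fin (n + 1) → Fin d, ∏ r, M r (u r) (u (r + 1)) := by
  rw [← (Fin.consEquiv fun _ : Fin (n + 1) => Fin d).sum_comp, Fintype.sum_prod_type, Matrix.trace]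
  refine Finset.sum_congr rfl fun a _ => ?_
  rw [Matrix.diag_apply, prod_ofFn_apply_eq_sum_paths]
  refine Finset.sum_congr rfl fun v _ => Finset.prod_congr rfl fun r _ => ?_
  simp only [Fin.consEquiv_apply]
  congr 1
  refine Fin.lastCases ?_ (fun r => ?_) r
  · rw [Fin.snoc_last, Fin.last_add_one, Fin.cons_zero]
  · rw [Fin.snoc_castSucc, Fin.coeSucc_eq_succ, Fin.cons_succ]

theorem formPerm_finRange_apply {n : ℕ} (r : Fin (n + 1)) :
    (List.finRange (n + 1)).formPerm r = r + 1 := by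
  have h := List.formPerm_apply_getElem (List.finRange (n + 1)) (List.nodup_finRange _) r
    (by simp; omega)
  simp only [List.getElem_finRange, List.length_finRange] at h
  convert! h using 1
  ext
  simp [Fin.val_add]

end CyclicTrace

/-! ### Action of the gates on density matrices. -/

section Gates

variable {a m d : ℕ}

/-- The permutation of basis labels implemented by a controlled swap. -/
def cswapLabel (c : Fin a) (r s : Fin m) (x : BasisLabel a m d) : BasisLabel a m d :=
  (x.1, if x.1 c = true then x.2 ∘ Equiv.swap r s else x.2)

theorem Gate.matrix_cswap_apply (c : Fin a) (r s : Fin m) (x y : BasisLabel a m d) :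
    (Gate.cswap c r s).matrix d x y = if cswapLabel c r s x = y then 1 else 0 := by
  have hinv : ∀ u v : Fin m → Fin d, u = v ∘ Equiv.swap r s ↔ u ∘ Equiv.swap r s = v := by
    intro u v
    constructor <;> rintro rfl <;> ext i <;> simp
  have h : (x.1 = y.1 ∧ x.2 = (if y.1 c = true then y.2 ∘ Equiv.swap r s else y.2)) ↔
      cswapLabel c r s x = y := by
    rw [Prod.ext_iff, cswapLabel]
    refine and_congr_right fun h => ?_
    rw [← h]
    split_ifs
    · exact hinv _ _
    · rfl
  simp only [Gate.matrix, h]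

theorem Gate.cswap_conj_apply (c : Fin a) (r s : Fin m)
    (τ : Matrix (BasisLabel a m d) (BasisLabel a m d) ℂ) (x y : BasisLabel a m d) :
    ((Gate.cswap c r s).matrix d * τ * ((Gate.cswap c r s).matrix d)ᴴ) x y =
      τ (cswapLabel c r s x) (cswapLabel c r s y) := by
  simp [Matrix.mul_apply, Gate.matrix_cswap_apply]

/-- The permutation of registers performed, if the control is set, by a list of controlled swaps. -/
def swapPerm (ps : List (Fin m × Fin m)) : Equiv.Perm (Fin m) :=
  (ps.map fun p => Equiv.swap p.1 p.2).prod⁻¹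

/-- Conjugation by a permutation matrix relabels the entries. Relabelling acts by precomposition, so
the order of the swaps is reversed; this accounts for the inverse in `swapPerm`. -/
theorem foldl_cswap_apply (c : Fin a) (ps : List (Fin m × Fin m))
    (τ : Matrix (BasisLabel a m d) (BasisLabel a m d) ℂ) (x y : BasisLabel a m d) :
    (ps.map fun p => Gate.cswap c p.1 p.2).foldl
        (fun τ g => g.matrix d * τ * (g.matrix d)ᴴ) τ x y =
      τ (x.1, if x.1 c = true then x.2 ∘ swapPerm ps else x.2)
        (y.1, if y.1 c = true then y.2 ∘ swapPerm ps else y.2) := by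
  induction ps generalizing τ with
  | nil => simp [swapPerm]
  | cons p ps ih =>
    have hperm : swapPerm (p :: ps) = swapPerm ps * Equiv.swap p.1 p.2 := by
      simp [swapPerm]
    have hl : ∀ z : BasisLabel a m d,
        cswapLabel c p.1 p.2 (z.1, if z.1 c = true then z.2 ∘ swapPerm ps else z.2) =
          (z.1, if z.1 c = true then z.2 ∘ swapPerm (p :: ps) else z.2) := by
      intro z
      rw [cswapLabel, hperm]
      by_cases h : z.1 c = true
      · simp [h, Function.comp_assoc]
      · simp [h]
    rw [List.map_cons, List.foldl_cons, ih, Gate.cswap_conj_apply, hl, hl]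

/-- The sign `-1` of the Hadamard matrix entry at `(1, 1)`. -/
def hadamardSign (b c : Bool) : ℂ := if b = true ∧ c = true then -1 else 1

theorem sum_fin_one_bool {M : Type*} [AddCommMonoid M] (f : (Fin 1 → Bool) → M) :
    ∑ b, f b = f (fun _ => true) + f (fun _ => false) := by
  rw [← (Equiv.funUnique (Fin 1) Bool).symm.sum_comp, Fintype.sum_bool]
  rfl

theorem Gate.matrix_hadamard_apply (x y : BasisLabel 1 m d) :
    (Gate.hadamard (a := 1) (m := m) 0).matrix d x y =
      if x.2 = y.2 then ((1 / Real.sqrt 2 : ℝ) : ℂ) * hadamardSign (x.1 0) (y.1 0) else 0 := by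
  have h : ∀ p : Fin 1, p ≠ 0 → x.1 p = y.1 p := fun p hp => absurd (Subsingleton.elim p 0) hp
  simp only [Gate.matrix, hadamardSign, and_iff_left h]

theorem Gate.hadamard_conj_apply (τ : Matrix (BasisLabel 1 m d) (BasisLabel 1 m d) ℂ)
    (x y : BasisLabel 1 m d) :
    ((Gate.hadamard (a := 1) (m := m) 0).matrix d * τ * ((Gate.hadamard (a := 1) (m := m) 0).matrix d)ᴴ) x y =
      1 / 2 * ∑ b : Fin 1 → Bool, ∑ c : Fin 1 → Bool,
        hadamardSign (x.1 0) (b 0) * hadamardSign (y.1 0) (c 0) * τ (b, x.2) (c, y.2) := by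
  have hsq : ((1 / Real.sqrt 2 : ℝ) : ℂ) * ((1 / Real.sqrt 2 : ℝ) : ℂ) = 1 / 2 := by
    rw [← Complex.ofReal_mul, div_mul_div_comm, Real.mul_self_sqrt (by norm_num)]
    norm_num
  have hstar : ∀ b c, star (hadamardSign b c) = hadamardSign b c := by
    intro b c
    unfold hadamardSign
    split_ifs <;> simp
  have hleft : ∀ z : BasisLabel 1 m d, ((Gate.hadamard (a := 1) (m := m) 0).matrix d * τ) x z =
      ((1 / Real.sqrt 2 : ℝ) : ℂ) * ∑ b : Fin 1 → Bool,
        hadamardSign (x.1 0) (b 0) * τ (b, x.2) z := by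
    intro z
    rw [Matrix.mul_apply, Fintype.sum_prod_type, Finset.mul_sum]
    refine Finset.sum_congr rfl fun b _ => ?_
    simp only [Gate.matrix_hadamard_apply, ite_mul, zero_mul, Finset.sum_ite_eq,
      Finset.mem_univ, if_true]
    ring
  rw [Matrix.mul_apply, Fintype.sum_prod_type, Finset.sum_comm, ← hsq]
  simp only [hleft, Matrix.conjTranspose_apply, Gate.matrix_hadamard_apply]
  rw [Finset.sum_eq_single y.2]
  · simp only [if_true, star_mul', hstar, RCLike.star_def, Complex.conj_ofReal, Finset.mul_sum,
      Finset.sum_mul]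
    rw [Finset.sum_comm]
    refine Finset.sum_congr rfl fun b _ => Finset.sum_congr rfl fun c _ => ?_
    ring
  · intro v _ hv
    simp [Ne.symm hv]
  · simp

/-- Hadamard gate, controlled swaps, Hadamard gate: diagonal entries of the final state. -/
theorem foldl_swapTest_apply_diag (ps : List (Fin m × Fin m))
    (Ω : (Fin m → Fin d) → (Fin m → Fin d) → ℂ)
    (τ₀ : Matrix (BasisLabel 1 m d) (BasisLabel 1 m d) ℂ)
    (hτ₀ : ∀ x y, τ₀ x y =
      (if (∀ q, x.1 q = false) ∧ (∀ q, y.1 q = false) then 1 else 0) * Ω x.2 y.2)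
    (b : Fin 1 → Bool) (u : Fin m → Fin d) :
    (Gate.hadamard 0 :: (ps.map fun p => Gate.cswap 0 p.1 p.2) ++
        [Gate.hadamard 0] : List (Gate 1 m)).foldl
        (fun (τ : Matrix (BasisLabel 1 m d) (BasisLabel 1 m d) ℂ) g =>
          g.matrix d * τ * (g.matrix d)ᴴ)
      τ₀ (b, u) (b, u) =
      1 / 4 * (Ω u u + Ω (u ∘ swapPerm ps) (u ∘ swapPerm ps) +
        (if b 0 = true then -1 else 1) * (Ω (u ∘ swapPerm ps) u + Ω u (u ∘ swapPerm ps))) := by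
  rw [List.cons_append, List.foldl_cons, List.foldl_append, List.foldl_cons, List.foldl_nil,
    Gate.hadamard_conj_apply]
  simp only [foldl_cswap_apply, Gate.hadamard_conj_apply, hτ₀, sum_fin_one_bool,
    Fin.forall_fin_one]
  rcases h : b 0 <;> simp [hadamardSign] <;> ring

end Gates

/-! ### Outcome distribution of the cyclic swap test. -/

section CyclicCircuit

variable {d : ℕ}

/-- The generalized swap test: one ancilla controls swaps of neighbouring registers, which together
permute the registers cyclically. -/
def cyclicCircuit {m : ℕ} (input : Fin m → Source) : Circuit where
  ancillas := 1
  registers := m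
  input := input
  gates := Gate.hadamard 0 ::
    (((List.finRange m).zip (List.finRange m).tail).map fun p => Gate.cswap 0 p.1 p.2) ++
      [Gate.hadamard 0]

theorem swapPerm_zip_tail {m : ℕ} (l : List (Fin m)) : swapPerm (l.zip l.tail) = l.formPerm⁻¹ := by
  rw [swapPerm, List.formPerm, List.zip, List.map_zipWith]

theorem cyclicCircuit_cswaps_le {m : ℕ} (input : Fin m → Source) :
    (cyclicCircuit input).cswaps ≤ m := by
  simp only [Circuit.cswaps, cyclicCircuit, List.cons_append, List.countP_cons, List.countP_append]
  refine (add_le_add (add_le_add List.countP_le_length le_rfl) le_rfl).trans ?_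
  simp

theorem sum_prod_diag_eq_one {m : ℕ} {ω : Fin m → Matrix (Fin d) (Fin d) ℂ}
    (hω : ∀ r, (ω r).trace = 1) : ∑ u : Fin m → Fin d, ∏ r, ω r (u r) (u r) = 1 := by
  have h := Finset.prod_univ_sum (fun _ : Fin m => (Finset.univ : Finset (Fin d)))
    (fun r a => ω r a a)
  rw [Fintype.piFinset_univ] at h
  rw [← h]
  exact Finset.prod_eq_one fun r _ => hω r

theorem sum_comp_perm {m : ℕ} {M : Type*} [AddCommMonoid M] (P : Equiv.Perm (Fin m))
    (f : (Fin m → Fin d) → M) : ∑ u : Fin m → Fin d, f (u ∘ P) = ∑ u, f u :=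
  (P.symm.arrowCongr (Equiv.refl (Fin d))).sum_comp f

/-- After the second Hadamard gate the two diagonal terms each contribute total weight 1. The
interference terms pair the product state with its cyclic shift, which gives the trace of the
product of the registers' states. -/
theorem cyclicCircuit_outcomeProb {m : ℕ} (hm : m ≠ 0) (input : Fin m → Source)
    {ρ σ : Matrix (Fin d) (Fin d) ℂ} (hρ : IsDensityMatrix ρ) (hσ : IsDensityMatrix σ) {v : ℝ}
    (hv : (List.ofFn fun r => (input r).state ρ σ).prod.trace = v) (b : Fin 1 → Bool) :
    (cyclicCircuit input).outcomeProb ρ σ b = (1 + (if b 0 = true then -1 else 1) * v) / 2 := by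
  obtain ⟨m, rfl⟩ := Nat.exists_eq_succ_of_ne_zero hm
  set ω : Fin (m + 1) → Matrix (Fin d) (Fin d) ℂ := fun r => (input r).state ρ σ with hω
  have hωd : ∀ r, IsDensityMatrix (ω r) := fun r => by
    simp only [hω]
    cases input r
    · exact hρ
    · exact hσ
  set Ω : (Fin (m + 1) → Fin d) → (Fin (m + 1) → Fin d) → ℂ := fun u w => ∏ r, ω r (u r) (w r)
    with hΩ
  set P := swapPerm ((List.finRange (m + 1)).zip (List.finRange (m + 1)).tail) with hP
  have hΩstar : ∀ u w, star (Ω u w) = Ω w u := fun u w => by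
    simp only [hΩ, star_prod]
    exact Finset.prod_congr rfl fun r _ => (hωd r).1.isHermitian.apply _ _
  have h1 : ∑ u, Ω u u = 1 := sum_prod_diag_eq_one fun r => (hωd r).2
  have h2 : ∑ u : Fin (m + 1) → Fin d, Ω (u ∘ P) (u ∘ P) = 1 := by
    rw [sum_comp_perm P fun u => Ω u u, h1]
  have h3 : ∑ u : Fin (m + 1) → Fin d, Ω (u ∘ P) u = v := by
    rw [← hv, trace_prod_ofFn_eq_sum_cycle, ← sum_comp_perm P⁻¹]
    refine Finset.sum_congr rfl fun u _ => Finset.prod_congr rfl fun r _ => ?_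
    have hPr : P⁻¹ r = r + 1 := by
      rw [hP, swapPerm_zip_tail, inv_inv, formPerm_finRange_apply]
    simp only [Function.comp_apply, hPr, ← Equiv.Perm.mul_apply, inv_mul_cancel]
    simp
  -- The other interference term is the complex conjugate, and `v` is real.
  have h4 : ∑ u : Fin (m + 1) → Fin d, Ω u (u ∘ P) = v := by
    have h := congrArg star h3
    rw [star_sum] at h
    simp only [hΩstar] at h
    rw [h]
    simp
  have hsum : ∑ u : Fin (m + 1) → Fin d, 1 / 4 * (Ω u u + Ω (u ∘ P) (u ∘ P) +
      (if b 0 = true then -1 else 1) * (Ω (u ∘ P) u + Ω u (u ∘ P))) =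
      (((1 + (if b 0 = true then -1 else 1) * v) / 2 : ℝ) : ℂ) := by
    rw [← Finset.mul_sum, Finset.sum_add_distrib, Finset.sum_add_distrib, ← Finset.mul_sum,
      Finset.sum_add_distrib, h1, h2, h3, h4]
    split_ifs <;> push_cast <;> ring
  rw [← Complex.ofReal_re ((1 + (if b 0 = true then -1 else 1) * v) / 2), ← hsum]
  refine congrArg Complex.re (Finset.sum_congr rfl fun u _ => ?_)
  exact foldl_swapTest_apply_diag _ Ω _ (fun _ _ => rfl) b u

end CyclicCircuit

/-! ### Hoeffding's inequality and the union bound over all quantities. -/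

section Concentration

open MeasureTheory ProbabilityTheory

/-- Hoeffding's inequality for the sample mean of independent copies of a variable in `[-1, 1]`. -/
theorem measure_pi_abs_mean_sub_gt_le {α : Type*} [MeasurableSpace α] (μ : Measure α)
    [IsProbabilityMeasure μ] {f : α → ℝ} (hf : Measurable f) (hf1 : ∀ x, |f x| ≤ 1) {κ : ℝ}
    (hκ : 0 ≤ κ) {N : ℕ} (hN : 1 ≤ N) :
    Measure.pi (fun _ : Fin N => μ) {ω | κ < |(∑ n, f (ω n)) / N - ∫ x, f x ∂μ|} ≤
      ENNReal.ofReal (2 * Real.exp (-(N * κ ^ 2 / 2))) := by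
  have hN0 : (0 : ℝ) < N := by exact_mod_cast hN
  have main : ∀ g : α → ℝ, Measurable g → (∀ x, |g x| ≤ 1) →
      (Measure.pi (fun _ : Fin N => μ)).real {ω | N * κ ≤ ∑ n, (g (ω n) - ∫ x, g x ∂μ)} ≤
        Real.exp (-(N * κ ^ 2 / 2)) := by
    intro g hg hg1
    have hsub : HasSubgaussianMGF (fun x => g x - ∫ x, g x ∂μ) 1 μ := by
      -- The variance proxy is the squared half-length of `[-1, 1]`, hence 1.
      have h := hasSubgaussianMGF_of_mem_Icc (μ := μ) (a := -1) (b := 1) hg.aemeasurable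
        (Filter.Eventually.of_forall fun x => abs_le.1 (hg1 x))
      convert h using 1
      ext
      norm_num
    have hind : iIndepFun (fun (i : Fin N) (ω : Fin N → α) => g (ω i) - ∫ x, g x ∂μ)
        (Measure.pi fun _ => μ) :=
      iIndepFun_pi (X := fun _ x => g x - ∫ x, g x ∂μ)
        fun _ => (hg.sub_const _).aemeasurable
    have hsubi : ∀ i ∈ (Finset.univ : Finset (Fin N)),
        HasSubgaussianMGF (fun ω : Fin N → α => g (ω i) - ∫ x, g x ∂μ) 1
          (Measure.pi fun _ => μ) := by
      intro i _
      refine HasSubgaussianMGF.of_map (Y := fun ω : Fin N → α => ω i)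
        (X := fun x => g x - ∫ x, g x ∂μ) (measurable_pi_apply i).aemeasurable ?_
      rw [(measurePreserving_eval (fun _ : Fin N => μ) i).map_eq]
      exact hsub
    have h := HasSubgaussianMGF.measure_sum_ge_le_of_iIndepFun hind hsubi
      (ε := N * κ) (by positivity)
    refine h.trans (Real.exp_le_exp.2 (le_of_eq ?_))
    simp
    field_simp
  have h1 := main f hf hf1
  have h2 := main (fun x => -f x) hf.neg (fun x => by rw [abs_neg]; exact hf1 x)
  have hsubset : {ω : Fin N → α | κ < |(∑ n, f (ω n)) / N - ∫ x, f x ∂μ|} ⊆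
      {ω | N * κ ≤ ∑ n, (f (ω n) - ∫ x, f x ∂μ)} ∪
        {ω | N * κ ≤ ∑ n, (-f (ω n) - ∫ x, -f x ∂μ)} := by
    intro ω hω
    simp only [Set.mem_ofPred_eq, Set.mem_union] at hω ⊢
    have hs : ∑ n, (f (ω n) - ∫ x, f x ∂μ) =
        N * ((∑ n, f (ω n)) / N - ∫ x, f x ∂μ) := by
      rw [Finset.sum_sub_distrib]
      simp
      field_simp
    have hs2 : ∑ n, (-f (ω n) - ∫ x, -f x ∂μ) =
        N * -((∑ n, f (ω n)) / N - ∫ x, f x ∂μ) := by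
      rw [mul_neg, ← hs, ← Finset.sum_neg_distrib, integral_neg]
      exact Finset.sum_congr rfl fun n _ => by ring
    rw [hs, hs2]
    rcases lt_abs.1 hω with h | h
    · exact Or.inl (mul_le_mul_of_nonneg_left h.le hN0.le)
    · exact Or.inr (mul_le_mul_of_nonneg_left h.le hN0.le)
  rw [two_mul, ENNReal.ofReal_add (Real.exp_nonneg _) (Real.exp_nonneg _)]
  refine (measure_mono hsubset).trans ((measure_union_le _ _).trans (add_le_add ?_ ?_))
  · rw [← ofReal_measureReal]
    exact ENNReal.ofReal_le_ofReal h1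
  · rw [← ofReal_measureReal]
    exact ENNReal.ofReal_le_ofReal h2

namespace Circuit

variable {d : ℕ} (c : Circuit) {ρ σ : Matrix (Fin d) (Fin d) ℂ}

theorem abs_signValue_le_one (x : Fin c.ancillas → Bool) : |c.signValue x| ≤ 1 := by
  rw [signValue, Finset.abs_prod]
  refine (Finset.prod_eq_one fun q _ => ?_).le
  split_ifs <;> simp

theorem isProbabilityMeasure_outcomeLaw (h0 : ∀ x, 0 ≤ c.outcomeProb ρ σ x)
    (h1 : ∑ x, c.outcomeProb ρ σ x = 1) : IsProbabilityMeasure (c.outcomeLaw ρ σ) := by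
  constructor
  rw [outcomeLaw, Measure.finsetSum_apply]
  simp only [Measure.smul_apply, measure_univ, smul_eq_mul, mul_one]
  rw [← ENNReal.ofReal_sum_of_nonneg fun x _ => h0 x, h1, ENNReal.ofReal_one]

theorem integral_signValue_outcomeLaw (h0 : ∀ x, 0 ≤ c.outcomeProb ρ σ x) :
    ∫ x, c.signValue x ∂(c.outcomeLaw ρ σ) = ∑ x, c.outcomeProb ρ σ x * c.signValue x := by
  rw [outcomeLaw, integral_finsetSum_measure]
  · refine Finset.sum_congr rfl fun x _ => ?_
    rw [integral_smul_measure, integral_dirac, ENNReal.toReal_ofReal (h0 x), smul_eq_mul]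
  · intro x _
    exact (integrable_dirac (by simp)).smul_measure ENNReal.ofReal_ne_top

end Circuit

namespace Protocol

variable {d : ℕ} (P : Protocol) {ρ σ : Matrix (Fin d) (Fin d) ℂ}

theorem isProbabilityMeasure_law
    (hprob : ∀ q, IsProbabilityMeasure ((P.circuit q).outcomeLaw ρ σ)) :
    IsProbabilityMeasure (P.law ρ σ) := by
  unfold law
  infer_instance

theorem law_exists_abs_estimate_sub_gt_le
    (hprob : ∀ q, IsProbabilityMeasure ((P.circuit q).outcomeLaw ρ σ))
    {v κ : Quantity P.cutoff → ℝ}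
    (hv : ∀ q, ∫ x, (P.circuit q).signValue x ∂((P.circuit q).outcomeLaw ρ σ) = v q)
    (hκ : ∀ q, 0 ≤ κ q) (hruns : ∀ q, 1 ≤ P.runs q) :
    P.law ρ σ {ω | ∃ q, κ q < |P.estimate ω q - v q|} ≤
      ∑ q, ENNReal.ofReal (2 * Real.exp (-(P.runs q * κ q ^ 2 / 2))) := by
  have hunion : {ω : P.Record | ∃ q, κ q < |P.estimate ω q - v q|} =
      ⋃ q ∈ (Finset.univ : Finset (Quantity P.cutoff)),
        {ω : P.Record | κ q < |P.estimate ω q - v q|} := by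
    ext ω; simp
  rw [hunion]
  refine (measure_biUnion_finset_le _ _).trans (Finset.sum_le_sum fun q _ => ?_)
  have hpre : {ω : P.Record | κ q < |P.estimate ω q - v q|} = (fun ω : P.Record => ω q) ⁻¹'
      {ω | κ q < |(∑ n, (P.circuit q).signValue (ω n)) / P.runs q -
        ∫ x, (P.circuit q).signValue x ∂((P.circuit q).outcomeLaw ρ σ)|} := by
    ext ω
    simp [estimate, hv]
  rw [hpre, law, (measurePreserving_eval (fun q => Measure.pi fun _ : Fin (P.runs q) =>
    (P.circuit q).outcomeLaw ρ σ) q).measure_preimage (Set.toFinite _).measurableSet.nullMeasurableSet]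
  exact measure_pi_abs_mean_sub_gt_le _ (measurable_of_countable _)
    (P.circuit q).abs_signValue_le_one (hκ q) (hruns q)

end Protocol

end Concentration

/-! ### Error of the full post-processing. -/

section MixedMoments

variable {ι ι' : Type*} [Fintype ι] [Fintype ι'] {x : ι → ℝ} {y : ι' → ℝ} {p : ι → ι' → ℝ}

theorem le_one_of_sum_eq_one (hx : ∀ a, 0 ≤ x a) (hx1 : ∑ a, x a = 1) (a : ι) : x a ≤ 1 := by
  rw [← hx1]
  exact Finset.single_le_sum (fun a _ => hx a) (Finset.mem_univ a)

theorem sum_mul_pow_mem_unitInterval (hx : ∀ a, 0 ≤ x a) (hx1 : ∑ a, x a = 1) {w : ι → ℝ}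
    (hw : ∀ a, 0 ≤ w a) (hw1 : ∑ a, w a = 1) (i : ℕ) :
    0 ≤ ∑ a, w a * x a ^ i ∧ ∑ a, w a * x a ^ i ≤ 1 := by
  refine ⟨Finset.sum_nonneg fun a _ => mul_nonneg (hw a) (pow_nonneg (hx a) _), ?_⟩
  rw [← hw1]
  exact Finset.sum_le_sum fun a _ => mul_le_of_le_one_right (hw a)
    (pow_le_one₀ (hx a) (le_one_of_sum_eq_one hx hx1 a))

theorem mixedMoment_mem_unitInterval (hx : ∀ a, 0 ≤ x a) (hx1 : ∑ a, x a = 1)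
    (hy : ∀ b, 0 ≤ y b) (hy1 : ∑ b, y b = 1) (hp : ∀ a b, 0 ≤ p a b)
    (hrow : ∀ a, ∑ b, p a b = 1) {i : ℕ} (hi : 1 ≤ i) (j : ℕ) :
    0 ≤ ∑ a, ∑ b, p a b * x a ^ i * y b ^ j ∧ ∑ a, ∑ b, p a b * x a ^ i * y b ^ j ≤ 1 := by
  have hrw : ∀ a, ∑ b, p a b * x a ^ i * y b ^ j = x a ^ i * ∑ b, p a b * y b ^ j := fun a => by
    rw [Finset.mul_sum]
    exact Finset.sum_congr rfl fun b _ => by ring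
  simp only [hrw]
  have hw := fun a => sum_mul_pow_mem_unitInterval hy hy1 (hp a) (hrow a) j
  refine ⟨Finset.sum_nonneg fun a _ => mul_nonneg (pow_nonneg (hx a) _) (hw a).1, ?_⟩
  rw [← hx1]
  refine Finset.sum_le_sum fun a _ => ?_
  exact (mul_le_of_le_one_right (pow_nonneg (hx a) _) (hw a).2).trans
    (pow_le_of_le_one (hx a) (le_one_of_sum_eq_one hx hx1 a) (by omega))

/-- Error propagation through both continuations of the post-processing. -/
theorem abs_postProcess_sub_le (hx : ∀ a, 0 ≤ x a) (hx1 : ∑ a, x a = 1)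
    (hy : ∀ b, 0 ≤ y b) (hy1 : ∑ b, y b = 1) (hp : ∀ a b, 0 ≤ p a b)
    (hrow : ∀ a, ∑ b, p a b = 1) (hcol : ∀ b, ∑ a, p a b = 1)
    {s k l : ℕ} {ηρ ησ κ θ : ℝ} (hs : 1 ≤ s) (hηρ : 0 ≤ ηρ) (hηρ1 : ηρ ≤ 1) (hησ : 0 ≤ ησ)
    (hησ1 : ησ ≤ 1) (hκ : 0 ≤ κ) (hθ : 0 ≤ θ)
    (htailx : (Finset.univ.filter fun a => x a ≠ 0).card ≤ s ∨ (2 : ℝ) / s.factorial ≤ θ)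
    (htaily : (Finset.univ.filter fun b => y b ≠ 0).card ≤ s ∨ (2 : ℝ) / s.factorial ≤ θ)
    (hk : k * (3 * ηρ * s + θ) ≤ 1) (hl : l * (3 * ησ * s + θ) ≤ 1)
    {Q : Quantity s → ℝ} (hQρ : ∀ i, |Q (.inl i) - ∑ a, x a ^ (i : ℕ)| ≤ ηρ)
    (hQσ : ∀ j, |Q (.inr (.inl j)) - ∑ b, y b ^ (j : ℕ)| ≤ ησ)
    (hQ : ∀ i j, |Q (.inr (.inr (i, j))) -
      ∑ a, ∑ b, p a b * x a ^ (i : ℕ) * y b ^ (j : ℕ)| ≤ κ)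
    {i j : ℕ} (hi : 1 ≤ i) (hik : i ≤ k) (hj : 1 ≤ j) (hjl : j ≤ l) :
    |(postProcess s Q i j) - ∑ a, ∑ b, p a b * x a ^ i * y b ^ j| ≤
      12 * s * (12 * s * κ + 9 * l * s * ησ + 6 * l * θ) + 9 * k * s * ηρ + 6 * k * θ := by
  have hv1 : ∀ i j, ∑ a, ∑ b, p a b * x a ^ i * y b ^ j =
      ∑ b, (∑ a, p a b * x a ^ i) * y b ^ j := fun i j => by
    rw [Finset.sum_comm]
    exact Finset.sum_congr rfl fun b _ => (Finset.sum_mul _ _ _).symm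
  have hv2 : ∀ i j, ∑ a, ∑ b, p a b * x a ^ i * y b ^ j =
      ∑ a, (∑ b, p a b * y b ^ j) * x a ^ i := fun i j => by
    refine Finset.sum_congr rfl fun a _ => ?_
    rw [Finset.sum_mul]
    exact Finset.sum_congr rfl fun b _ => by ring
  have hwx := fun i b => sum_mul_pow_mem_unitInterval hx hx1 (fun a => hp a b) (hcol b) i
  have hwy := fun j a => sum_mul_pow_mem_unitInterval hy hy1 (hp a) (hrow a) j
  unfold postProcess
  simp only
  rw [hv2]
  -- In the continuation in `i`, the weight of `x a` is `∑ b, p a b * y b ^ j`. The error of its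
  -- initial data is the error bound of the continuation in `j`, proved in the last goal.
  refine abs_extend_newtonGirard_sub_le hx hx1 (fun a => (hwy j a).1) (fun a => (hwy j a).2) hs
    hηρ hηρ1 (by positivity) hθ htailx ?_ ?_ hk i hi hik
  · intro m hm hms
    have hmem : m ∈ Finset.Icc 1 s := Finset.mem_Icc.2 ⟨hm, hms⟩
    rw [dif_pos hmem]
    exact hQρ ⟨m, hmem⟩
  · intro i' hi' his'
    have hmem' : i' ∈ Finset.Icc 1 s := Finset.mem_Icc.2 ⟨hi', his'⟩
    rw [← hv2, hv1]
    refine abs_extend_newtonGirard_sub_le hy hy1 (fun b => (hwx i' b).1) (fun b => (hwx i' b).2) hs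
      hησ hησ1 hκ hθ htaily ?_ ?_ hl j hj hjl
    · intro m hm hms
      have hmem : m ∈ Finset.Icc 1 s := Finset.mem_Icc.2 ⟨hm, hms⟩
      rw [dif_pos hmem]
      exact hQσ ⟨m, hmem⟩
    · intro m hm hms
      have hmem : m ∈ Finset.Icc 1 s := Finset.mem_Icc.2 ⟨hm, hms⟩
      rw [dif_pos ⟨hmem', hmem⟩, ← hv1]
      exact hQ ⟨i', hmem'⟩ ⟨m, hmem⟩

end MixedMoments

/-! ### The swap test for a single moment. -/

section MomentCircuit

variable {d : ℕ} {ρ σ : Matrix (Fin d) (Fin d) ℂ}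

/-- The cyclic swap test on `i` copies of `ρ` followed by `j` copies of `σ`. -/
def momentCircuit (i j : ℕ) : Circuit :=
  cyclicCircuit (Fin.append (fun _ : Fin i => Source.rho) fun _ : Fin j => Source.sigma)

theorem momentCircuit_copies_rho (i j : ℕ) : (momentCircuit i j).copies .rho = i := by
  change (Finset.univ.filter fun r : Fin (i + j) =>
    Fin.append (fun _ : Fin i => Source.rho) (fun _ : Fin j => Source.sigma) r = .rho).card = i
  rw [Finset.card_filter, Fin.sum_univ_add]
  simp

theorem momentCircuit_copies_sigma (i j : ℕ) : (momentCircuit i j).copies .sigma = j := by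
  change (Finset.univ.filter fun r : Fin (i + j) =>
    Fin.append (fun _ : Fin i => Source.rho) (fun _ : Fin j => Source.sigma) r = .sigma).card = j
  rw [Finset.card_filter, Fin.sum_univ_add]
  simp

theorem momentCircuit_cswaps_le (i j : ℕ) : (momentCircuit i j).cswaps ≤ i + j :=
  cyclicCircuit_cswaps_le _

/-- A real moment in `[0, 1]` makes the values `(1 ± v) / 2` genuine probabilities. -/
theorem IsDensityMatrix.trace_pow_mul_pow_mem (hρ : IsDensityMatrix ρ) (hσ : IsDensityMatrix σ)
    {i j : ℕ} (hij : i + j ≠ 0) :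
    ∃ v : ℝ, (ρ ^ i * σ ^ j).trace = v ∧ 0 ≤ v ∧ v ≤ 1 := by
  obtain ⟨p, hp, hrow, hcol, htr⟩ :=
    exists_doublyStochastic_trace_eq hρ.1.isHermitian hσ.1.isHermitian
  refine ⟨_, htr i j, ?_⟩
  have hx := hρ.1.eigenvalues_nonneg
  have hy := hσ.1.eigenvalues_nonneg
  rcases Nat.eq_zero_or_pos i with rfl | hi
  -- The general bound needs its first exponent positive, so the roles of the two states are
  -- exchanged.
  · have h := mixedMoment_mem_unitInterval hy hσ.sum_eigenvalues hx hρ.sum_eigenvalues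
      (fun b a => hp a b) hcol (i := j) (by omega) 0
    rw [Finset.sum_comm] at h
    simpa using h
  · exact mixedMoment_mem_unitInterval hx hρ.sum_eigenvalues hy hσ.sum_eigenvalues hp hrow hi j

theorem momentCircuit_outcomeProb (hρ : IsDensityMatrix ρ) (hσ : IsDensityMatrix σ)
    {i j : ℕ} (hij : i + j ≠ 0) {v : ℝ} (hv : (ρ ^ i * σ ^ j).trace = v) (b : Fin 1 → Bool) :
    (momentCircuit i j).outcomeProb ρ σ b = (1 + (if b 0 = true then -1 else 1) * v) / 2 := by
  refine cyclicCircuit_outcomeProb hij _ hρ hσ ?_ b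
  rw [← hv, List.ofFn_add]
  simp [Source.state]

theorem momentCircuit_signValue (i j : ℕ) (b : Fin 1 → Bool) :
    (momentCircuit i j).signValue b = if b 0 = true then -1 else 1 := by
  change ∏ q : Fin 1, _ = _
  simp

theorem momentCircuit_outcomeProb_nonneg (hρ : IsDensityMatrix ρ) (hσ : IsDensityMatrix σ)
    {i j : ℕ} (hij : i + j ≠ 0) (b : Fin 1 → Bool) :
    0 ≤ (momentCircuit i j).outcomeProb ρ σ b := by
  obtain ⟨v, hv, hv0, hv1⟩ := hρ.trace_pow_mul_pow_mem hσ hij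
  rw [momentCircuit_outcomeProb hρ hσ hij hv]
  split_ifs <;> linarith

theorem momentCircuit_sum_outcomeProb (hρ : IsDensityMatrix ρ) (hσ : IsDensityMatrix σ)
    {i j : ℕ} (hij : i + j ≠ 0) :
    ∑ b : Fin 1 → Bool, (momentCircuit i j).outcomeProb ρ σ b = 1 := by
  obtain ⟨v, hv, -⟩ := hρ.trace_pow_mul_pow_mem hσ hij
  refine (sum_fin_one_bool _).trans ?_
  rw [momentCircuit_outcomeProb hρ hσ hij hv, momentCircuit_outcomeProb hρ hσ hij hv]
  simp
  ring

theorem momentCircuit_expectation (hρ : IsDensityMatrix ρ) (hσ : IsDensityMatrix σ)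
    {i j : ℕ} (hij : i + j ≠ 0) :
    ((∑ b : Fin 1 → Bool, (momentCircuit i j).outcomeProb ρ σ b *
      (momentCircuit i j).signValue b : ℝ) : ℂ) = (ρ ^ i * σ ^ j).trace := by
  obtain ⟨v, hv, -⟩ := hρ.trace_pow_mul_pow_mem hσ hij
  rw [hv, sum_fin_one_bool, momentCircuit_outcomeProb hρ hσ hij hv,
    momentCircuit_outcomeProb hρ hσ hij hv, momentCircuit_signValue, momentCircuit_signValue]
  simp
  ring

end MomentCircuit

/-! ### Precision and number of runs. -/

section Sampling

/-- Precision to which a quantity is estimated when its sensitivity is `K`. -/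
noncomputable def tolerance (ε : ℝ) (s K : ℕ) : ℝ := ε / (1000 * K * s ^ 2)

/-- Number of runs sufficient for precision `tolerance ε s K` with failure probability
`δ / (3 s²)`. -/
noncomputable def runCount (ε δ : ℝ) (s K : ℕ) : ℕ :=
  ⌈2 / tolerance ε s K ^ 2 * Real.log (6 * s ^ 2 / δ)⌉₊

variable {ε δ : ℝ} {s K : ℕ}

theorem tolerance_pos (hε : 0 < ε) (hs : 1 ≤ s) (hK : 1 ≤ K) : 0 < tolerance ε s K := by
  unfold tolerance
  positivity

theorem tolerance_le_one (hε1 : ε < 1) (hs : 1 ≤ s) (hK : 1 ≤ K) : tolerance ε s K ≤ 1 := by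
  have hs' : (1 : ℝ) ≤ s := by exact_mod_cast hs
  have hK' : (1 : ℝ) ≤ K := by exact_mod_cast hK
  unfold tolerance
  rw [div_le_one (by positivity)]
  have : (1 : ℝ) ≤ K * s ^ 2 := one_le_mul_of_one_le_of_one_le hK' (one_le_pow₀ hs')
  linarith

theorem one_le_log_six_mul_sq_div (hδ : 0 < δ) (hδ1 : δ < 1) (hs : 1 ≤ s) :
    1 ≤ Real.log (6 * s ^ 2 / δ) := by
  have hs' : (1 : ℝ) ≤ s := by exact_mod_cast hs
  rw [Real.le_log_iff_exp_le (by positivity), le_div_iff₀ hδ]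
  have h1 : Real.exp 1 * δ ≤ 3 * 1 :=
    mul_le_mul (Real.exp_one_lt_d9.le.trans (by norm_num)) hδ1.le hδ.le (by norm_num)
  have h2 : (1 : ℝ) ≤ (s : ℝ) ^ 2 := one_le_pow₀ hs'
  linarith

theorem log_six_mul_sq_div_le (hδ : 0 < δ) (hδ1 : δ < 1) (hs : 1 ≤ s) :
    Real.log (6 * s ^ 2 / δ) ≤ 6 * s ^ 2 * Real.log (2 / δ) := by
  have hs' : (1 : ℝ) ≤ s := by exact_mod_cast hs
  have h2 : (1 : ℝ) ≤ (s : ℝ) ^ 2 := one_le_pow₀ hs'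
  have hsplit : (6 * (s : ℝ) ^ 2 / δ) = 3 * s ^ 2 * (2 / δ) := by ring
  -- A positive lower bound on `log (2 / δ)` lets the additive term `3 s²` be absorbed into a
  -- multiple of it.
  have hlog2 : (0.69 : ℝ) ≤ Real.log (2 / δ) := by
    have h : (2 : ℝ) ≤ 2 / δ := by
      rw [le_div_iff₀ hδ]; linarith
    exact (by linarith [Real.log_two_gt_d9] : (0.69 : ℝ) ≤ Real.log 2).trans
      (Real.log_le_log (by norm_num) h)
  rw [hsplit, Real.log_mul (by positivity) (by positivity)]
  have h3 : Real.log (3 * (s : ℝ) ^ 2) ≤ 3 * s ^ 2 := by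
    have := Real.log_le_sub_one_of_pos (show (0 : ℝ) < 3 * (s : ℝ) ^ 2 by positivity)
    linarith
  nlinarith

theorem one_le_runCount (hε : 0 < ε) (hδ : 0 < δ) (hδ1 : δ < 1) (hs : 1 ≤ s)
    (hK : 1 ≤ K) : 1 ≤ runCount ε δ s K := by
  have h1 := one_le_log_six_mul_sq_div hδ hδ1 hs
  have h2 := tolerance_pos hε hs hK
  exact Nat.ceil_pos.2 (by positivity)

theorem two_mul_exp_runCount_le (hε : 0 < ε) (hδ : 0 < δ) (hs : 1 ≤ s)
    (hK : 1 ≤ K) :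
    2 * Real.exp (-(runCount ε δ s K * tolerance ε s K ^ 2 / 2)) ≤ δ / (3 * s ^ 2) := by
  have h2 := tolerance_pos hε hs hK
  have hN : 2 / tolerance ε s K ^ 2 * Real.log (6 * s ^ 2 / δ) ≤ runCount ε δ s K :=
    Nat.le_ceil _
  have h3 : Real.log (6 * s ^ 2 / δ) ≤ runCount ε δ s K * tolerance ε s K ^ 2 / 2 := by
    have := mul_le_mul_of_nonneg_right hN (show 0 ≤ tolerance ε s K ^ 2 / 2 by positivity)
    refine le_trans (le_of_eq ?_) (this.trans (le_of_eq ?_))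
    · field_simp
    · ring
  have hs' : (0 : ℝ) < s := by exact_mod_cast hs
  calc 2 * Real.exp (-(runCount ε δ s K * tolerance ε s K ^ 2 / 2))
      ≤ 2 * Real.exp (-Real.log (6 * s ^ 2 / δ)) := by gcongr
    _ = δ / (3 * s ^ 2) := by
      rw [Real.exp_neg, Real.exp_log (by positivity)]
      field_simp
      norm_num

theorem runCount_le (hε : 0 < ε) (hε1 : ε < 1) (hδ : 0 < δ) (hδ1 : δ < 1) (hs : 1 ≤ s)
    (hK : 1 ≤ K) :
    (runCount ε δ s K : ℝ) ≤ 18 * 10 ^ 6 * (K ^ 2 / ε ^ 2) * s ^ 6 * Real.log (2 / δ) := by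
  have hpos := tolerance_pos hε hs hK
  have hle := tolerance_le_one hε1 hs hK
  have h1 := one_le_log_six_mul_sq_div hδ hδ1 hs
  have h2 := log_six_mul_sq_div_le hδ hδ1 hs
  have hinv : 1 ≤ 1 / tolerance ε s K ^ 2 := by
    rw [one_le_div (by positivity)]
    exact pow_le_one₀ hpos.le hle
  have hceil : (runCount ε δ s K : ℝ) ≤
      2 / tolerance ε s K ^ 2 * Real.log (6 * s ^ 2 / δ) + 1 :=
    (Nat.ceil_lt_add_one (by positivity)).le
  have hone : 1 ≤ 1 / tolerance ε s K ^ 2 * Real.log (6 * s ^ 2 / δ) :=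
    one_le_mul_of_one_le_of_one_le hinv h1
  have hs' : (0 : ℝ) < s := by exact_mod_cast hs
  have hK' : (0 : ℝ) < K := by exact_mod_cast hK
  calc (runCount ε δ s K : ℝ) ≤ 3 / tolerance ε s K ^ 2 * Real.log (6 * s ^ 2 / δ) := by
        refine hceil.trans ?_
        have : 3 / tolerance ε s K ^ 2 * Real.log (6 * s ^ 2 / δ) =
          2 / tolerance ε s K ^ 2 * Real.log (6 * s ^ 2 / δ) +
            1 / tolerance ε s K ^ 2 * Real.log (6 * s ^ 2 / δ) := by ring
        linarith
    _ ≤ 3 / tolerance ε s K ^ 2 * (6 * s ^ 2 * Real.log (2 / δ)) := by gcongr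
    _ = 18 * 10 ^ 6 * (K ^ 2 / ε ^ 2) * s ^ 6 * Real.log (2 / δ) := by
        unfold tolerance
        field_simp
        ring

end Sampling

/-! ### The protocol: copy counts and success probability. -/

section Protocol

/-- The exponents `(i, j)` for which a quantity is `Tr(ρ^i σ^j)`. -/
def Quantity.exponents {s : ℕ} : Quantity s → ℕ × ℕ
  | .inl i => (i, 0)
  | .inr (.inl j) => (0, j)
  | .inr (.inr ij) => (ij.1, ij.2)

/-- The factor by which the error of a quantity is amplified by the post-processing, up to factors
polynomial in the cutoff. -/
def Quantity.sensitivity {s : ℕ} (k l : ℕ) : Quantity s → ℕ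
  | .inl _ => k
  | .inr (.inl _) => l
  | .inr (.inr _) => 1

theorem Quantity.value_eq {s d : ℕ} (ρ σ : Matrix (Fin d) (Fin d) ℂ) (q : Quantity s) :
    q.value ρ σ = (ρ ^ q.exponents.1 * σ ^ q.exponents.2).trace := by
  rcases q with i | j | ij <;> simp [Quantity.value, Quantity.exponents]

theorem Quantity.exponents_bounds {s : ℕ} (q : Quantity s) :
    q.exponents.1 + q.exponents.2 ≠ 0 ∧ q.exponents.1 ≤ s ∧ q.exponents.2 ≤ s := by
  rcases q with i | j | ⟨i, j⟩ <;> simp only [Quantity.exponents]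
  · have := Finset.mem_Icc.1 i.2
    omega
  · have := Finset.mem_Icc.1 j.2
    omega
  · have := Finset.mem_Icc.1 i.2
    have := Finset.mem_Icc.1 j.2
    omega

theorem Quantity.one_le_cutoff {s : ℕ} (q : Quantity s) : 1 ≤ s := by
  have := q.exponents_bounds
  omega

theorem Quantity.one_le_sensitivity {s k l : ℕ} (hk : 1 ≤ k) (hl : 1 ≤ l) (q : Quantity s) :
    1 ≤ q.sensitivity k l := by
  rcases q with i | j | ij
  · exact hk
  · exact hl
  · exact le_rfl

/-- Every moment is estimated with the cyclic swap test, with a number of runs adapted to its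
sensitivity. -/
noncomputable def momentProtocol (k l : ℕ) (ε δ : ℝ) (s : ℕ) : Protocol where
  cutoff := s
  circuit q := momentCircuit q.exponents.1 q.exponents.2
  runs q := runCount ε δ s (q.sensitivity k l)

variable {k l s : ℕ} {ε δ : ℝ}

theorem card_quantity (s : ℕ) : Fintype.card (Quantity s) = s + (s + s * s) := by
  simp [Fintype.card_sum, Fintype.card_prod]

/-- Here `e` counts the copies of one source per run. Only quantities that use this source need
sensitivity at most `K`, so the precision demanded of the other state's power sums does not enter.
The ninth power is `s ^ 6` from the runs, `s` from the copies per run and `s ^ 2` from the number of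
quantities. -/
theorem sum_mul_le_of_sensitivity_le {K : ℕ} (hε : 0 < ε) (hε1 : ε < 1) (hδ : 0 < δ) (hδ1 : δ < 1)
    (hk : 1 ≤ k) (hl : 1 ≤ l) {e : Quantity s → ℕ} (he : ∀ q, e q ≤ s)
    (hK : ∀ q, e q ≠ 0 → q.sensitivity k l ≤ K) :
    ((∑ q : Quantity s, runCount ε δ s (q.sensitivity k l) * e q : ℕ) : ℝ) ≤
      54 * 10 ^ 6 * (K ^ 2 / ε ^ 2) * s ^ 9 * Real.log (2 / δ) := by
  rcases Nat.eq_zero_or_pos s with rfl | hs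
  · have : IsEmpty (Quantity 0) := ⟨fun q => by have := q.one_le_cutoff; omega⟩
    simp
  have hlog : 0 ≤ Real.log (2 / δ) := by
    refine Real.log_nonneg ?_
    rw [one_le_div hδ]; linarith
  have hs' : (1 : ℝ) ≤ s := by exact_mod_cast hs
  push_cast
  calc ∑ q : Quantity s, (runCount ε δ s (q.sensitivity k l) : ℝ) * e q
      ≤ ∑ q : Quantity s,
        (18 * 10 ^ 6 * (K ^ 2 / ε ^ 2) * s ^ 6 * Real.log (2 / δ)) * s := by
        refine Finset.sum_le_sum fun q _ => ?_
        by_cases h0 : e q = 0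
        · rw [h0]
          simp only [Nat.cast_zero, mul_zero]
          positivity
        · have h1 := runCount_le hε hε1 hδ hδ1 hs (q.one_le_sensitivity hk hl)
          have h2 : ((q.sensitivity k l : ℕ) : ℝ) ≤ K := by exact_mod_cast hK q h0
          have h3 : (e q : ℝ) ≤ s := by exact_mod_cast he q
          refine mul_le_mul (h1.trans ?_) h3 (by positivity) (by positivity)
          gcongr
    _ = (18 * 10 ^ 6 * (K ^ 2 / ε ^ 2) * s ^ 6 * Real.log (2 / δ)) * (s * (s + (s + s * s))) := by
        rw [Finset.sum_const, Finset.card_univ, card_quantity, nsmul_eq_mul]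
        push_cast
        ring
    _ ≤ (18 * 10 ^ 6 * (K ^ 2 / ε ^ 2) * s ^ 6 * Real.log (2 / δ)) * (3 * s ^ 3) := by
        refine mul_le_mul_of_nonneg_left ?_ (by positivity)
        nlinarith [mul_nonneg (show (0 : ℝ) ≤ s by linarith) (show (0 : ℝ) ≤ s by linarith)]
    _ = _ := by ring

theorem momentProtocol_copies_rho_le (hε : 0 < ε) (hε1 : ε < 1) (hδ : 0 < δ) (hδ1 : δ < 1)
    (hk : 1 ≤ k) (hl : 1 ≤ l) : ((momentProtocol k l ε δ s).copies .rho : ℝ) ≤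
      54 * 10 ^ 6 * (k ^ 2 / ε ^ 2) * s ^ 9 * Real.log (2 / δ) := by
  have h : (momentProtocol k l ε δ s).copies .rho =
      ∑ q : Quantity s, runCount ε δ s (q.sensitivity k l) * q.exponents.1 :=
    Finset.sum_congr rfl fun (q : Quantity s) _ =>
      congrArg (fun c => runCount ε δ s (q.sensitivity k l) * c)
        (momentCircuit_copies_rho q.exponents.1 q.exponents.2)
  rw [h]
  refine sum_mul_le_of_sensitivity_le hε hε1 hδ hδ1 hk hl (fun q => q.exponents_bounds.2.1) ?_
  rintro (i | j | ij) h
  · exact le_rfl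
  · exact absurd rfl h
  · exact hk

theorem momentProtocol_copies_sigma_le (hε : 0 < ε) (hε1 : ε < 1) (hδ : 0 < δ) (hδ1 : δ < 1)
    (hk : 1 ≤ k) (hl : 1 ≤ l) : ((momentProtocol k l ε δ s).copies .sigma : ℝ) ≤
      54 * 10 ^ 6 * (l ^ 2 / ε ^ 2) * s ^ 9 * Real.log (2 / δ) := by
  have h : (momentProtocol k l ε δ s).copies .sigma =
      ∑ q : Quantity s, runCount ε δ s (q.sensitivity k l) * q.exponents.2 :=
    Finset.sum_congr rfl fun (q : Quantity s) _ =>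
      congrArg (fun c => runCount ε δ s (q.sensitivity k l) * c)
        (momentCircuit_copies_sigma q.exponents.1 q.exponents.2)
  rw [h]
  refine sum_mul_le_of_sensitivity_le hε hε1 hδ hδ1 hk hl (fun q => q.exponents_bounds.2.2) ?_
  rintro (i | j | ij) h
  · exact absurd rfl h
  · exact le_rfl
  · exact hl

variable {d : ℕ} {ρ σ : Matrix (Fin d) (Fin d) ℂ}

/-- With high probability all quantities are estimated to the desired precision. -/
theorem momentProtocol_law_ge (hε : 0 < ε) (hδ : 0 < δ) (hδ1 : δ < 1)
    (hk : 1 ≤ k) (hl : 1 ≤ l) (hs : 1 ≤ s) (hρ : IsDensityMatrix ρ) (hσ : IsDensityMatrix σ)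
    {E : Set (momentProtocol k l ε δ s).Record}
    (hE : ∀ ω, (∀ q : Quantity s, |(momentProtocol k l ε δ s).estimate ω q -
      (q.value ρ σ).re| ≤ tolerance ε s (q.sensitivity k l)) → ω ∈ E) :
    ENNReal.ofReal (1 - δ) ≤ (momentProtocol k l ε δ s).law ρ σ E := by
  have hprob : ∀ q, MeasureTheory.IsProbabilityMeasure (((momentProtocol k l ε δ s).circuit q).outcomeLaw ρ σ) :=
    fun q : Quantity s => ((momentProtocol k l ε δ s).circuit q).isProbabilityMeasure_outcomeLaw
      (momentCircuit_outcomeProb_nonneg hρ hσ q.exponents_bounds.1)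
      (momentCircuit_sum_outcomeProb hρ hσ q.exponents_bounds.1)
  have hmean : ∀ q : Quantity s,
      ∫ x, ((momentProtocol k l ε δ s).circuit q).signValue x ∂(((momentProtocol k l ε δ s).circuit q).outcomeLaw ρ σ) = (q.value ρ σ).re := by
    intro q
    rw [((momentProtocol k l ε δ s).circuit q).integral_signValue_outcomeLaw
      (momentCircuit_outcomeProb_nonneg hρ hσ q.exponents_bounds.1), q.value_eq,
      ← momentCircuit_expectation hρ hσ q.exponents_bounds.1, Complex.ofReal_re]
    rfl
  have hbad := (momentProtocol k l ε δ s).law_exists_abs_estimate_sub_gt_le hprob hmean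
    (κ := fun q : Quantity s => tolerance ε s (q.sensitivity k l))
    (fun q : Quantity s => (tolerance_pos hε hs (q.one_le_sensitivity hk hl)).le)
    (fun q : Quantity s => one_le_runCount hε hδ hδ1 hs (q.one_le_sensitivity hk hl))
  have hs' : (1 : ℝ) ≤ s := by exact_mod_cast hs
  have hsum : ∑ q : Quantity s, ENNReal.ofReal
      (2 * Real.exp (-((momentProtocol k l ε δ s).runs q * tolerance ε s (q.sensitivity k l) ^ 2 / 2))) ≤
        ENNReal.ofReal δ := by
    rw [← ENNReal.ofReal_sum_of_nonneg fun _ _ => by positivity]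
    refine ENNReal.ofReal_le_ofReal ?_
    calc _ ≤ ∑ q : Quantity s, δ / (3 * (s : ℝ) ^ 2) :=
          Finset.sum_le_sum fun q _ =>
            two_mul_exp_runCount_le hε hδ hs (q.one_le_sensitivity hk hl)
      _ = (s + (s + s * s)) * (δ / (3 * (s : ℝ) ^ 2)) := by
          rw [Finset.sum_const, Finset.card_univ, card_quantity, nsmul_eq_mul]
          push_cast
          ring
      -- There are `2 s + s²` quantities, at most `3 s²`, which is why each gets failure budget `δ /
      -- (3 s²)`.
      _ ≤ 3 * s ^ 2 * (δ / (3 * (s : ℝ) ^ 2)) := by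
          refine mul_le_mul_of_nonneg_right ?_ (by positivity)
          nlinarith
      _ = δ := by field_simp
  have := (momentProtocol k l ε δ s).isProbabilityMeasure_law hprob
  set B : Set (momentProtocol k l ε δ s).Record := {ω | ∃ q : Quantity s, tolerance ε s (q.sensitivity k l) <
    |(momentProtocol k l ε δ s).estimate ω q - (q.value ρ σ).re|} with hB
  have hBδ : (momentProtocol k l ε δ s).law ρ σ B ≤ ENNReal.ofReal δ := hbad.trans hsum
  have hcover : (Set.univ : Set (momentProtocol k l ε δ s).Record) ⊆ E ∪ B := by
    intro ω _
    by_cases h : ω ∈ B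
    · exact Or.inr h
    · refine Or.inl (hE ω fun q => ?_)
      by_contra hq
      exact h ⟨q, not_le.1 hq⟩
  have h1 : 1 ≤ (momentProtocol k l ε δ s).law ρ σ E + ENNReal.ofReal δ := by
    rw [← MeasureTheory.measure_univ (μ := (momentProtocol k l ε δ s).law ρ σ)]
    exact (MeasureTheory.measure_mono hcover).trans
      ((MeasureTheory.measure_union_le _ _).trans (add_le_add le_rfl hBδ))
  rw [ENNReal.ofReal_sub _ hδ.le, ENNReal.ofReal_one]
  exact tsub_le_iff_right.2 h1

end Protocol

/-! ### Choice of the cutoff and final error budget. -/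

section Accuracy

/-- Since `L ≤ 2 ^ L` and `e < 3`, the left side is at most `1500 * 6 ^ L`, which the factorial
eventually dominates. -/
theorem exists_forall_mul_exp_le_factorial :
    ∃ L₀ : ℕ, 1 ≤ L₀ ∧ ∀ L ≥ L₀, 500 * (L : ℝ) * Real.exp (L + 1) ≤ L.factorial := by
  have h := FloorSemiring.tendsto_pow_div_factorial_atTop (6 : ℝ)
  have h2 := (h.eventually_le_const (show (0 : ℝ) < 1 / 1500 by norm_num)).exists_forall_of_atTop
  obtain ⟨L₀, hL₀⟩ := h2
  refine ⟨max 1 L₀, le_max_left _ _, fun L hL => ?_⟩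
  have h3 := hL₀ L ((le_max_right _ _).trans hL)
  rw [div_le_iff₀ (by positivity)] at h3
  have h4 : (L : ℝ) ≤ 2 ^ L := by exact_mod_cast Nat.lt_two_pow_self.le
  have h5 : Real.exp (L + 1) ≤ 3 ^ (L + 1) := by
    have : ((L : ℝ) + 1) = ((L + 1 : ℕ) : ℝ) * 1 := by push_cast; ring
    rw [this, Real.exp_nat_mul]
    gcongr
    exact Real.exp_one_lt_d9.le.trans (by norm_num)
  calc 500 * (L : ℝ) * Real.exp (L + 1) ≤ 500 * 2 ^ L * 3 ^ (L + 1) := by gcongr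
    _ = 1500 * 6 ^ L := by
      rw [show (6 : ℝ) = 2 * 3 by norm_num, mul_pow, pow_succ]; ring
    _ ≤ L.factorial := by linarith

theorem IsDensityMatrix.rank_ne_zero {d : ℕ} {ρ : Matrix (Fin d) (Fin d) ℂ}
    (hρ : IsDensityMatrix ρ) : ρ.rank ≠ 0 := by
  intro h
  rw [← hρ.1.isHermitian.card_filter_eigenvalues_ne_zero, Finset.card_eq_zero] at h
  have h1 := hρ.sum_eigenvalues
  rw [Finset.sum_eq_zero fun a ha => ?_] at h1
  · exact zero_ne_one h1
  · by_contra hne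
    have : a ∈ Finset.univ.filter fun a => hρ.1.isHermitian.eigenvalues a ≠ 0 := by
      simpa using hne
    rw [h] at this
    simp at this

variable {k l s d : ℕ} {ε δ : ℝ} {ρ σ : Matrix (Fin d) (Fin d) ℂ}

/-- With these tolerances every term of the propagated error is a multiple of `ε / 1000`. The
coefficients 144, 108, 72, 9 and 6 add up to less than 1000. -/
theorem norm_postProcess_sub_trace_le (hε : 0 < ε) (hε1 : ε < 1) (hk : 1 ≤ k) (hl : 1 ≤ l)
    (hs : 1 ≤ s) (hρ : IsDensityMatrix ρ) (hσ : IsDensityMatrix σ)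
    (htail : (ρ.rank ≤ s ∧ σ.rank ≤ s) ∨
      (2 : ℝ) / s.factorial ≤ ε / (1000 * (k + l) * s)) {Q : Quantity s → ℝ}
    (hQ : ∀ q : Quantity s, |Q q - (q.value ρ σ).re| ≤ tolerance ε s (q.sensitivity k l))
    {i j : ℕ} (hi : 1 ≤ i) (hik : i ≤ k) (hj : 1 ≤ j) (hjl : j ≤ l) :
    ‖(postProcess s Q i j : ℂ) - (ρ ^ i * σ ^ j).trace‖ ≤ ε := by
  obtain ⟨p, hp, hrow, hcol, htr⟩ :=
    exists_doublyStochastic_trace_eq hρ.1.isHermitian hσ.1.isHermitian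
  have hQρ : ∀ i : Finset.Icc 1 s,
      |Q (.inl i) - ∑ a, hρ.1.isHermitian.eigenvalues a ^ (i : ℕ)| ≤ tolerance ε s k := by
    intro i
    have h := hQ (.inl i)
    rw [Quantity.value_eq, htr, Complex.ofReal_re] at h
    simpa [Quantity.exponents, Quantity.sensitivity, ← Finset.sum_mul, hrow] using h
  have hQσ : ∀ j : Finset.Icc 1 s,
      |Q (.inr (.inl j)) - ∑ b, hσ.1.isHermitian.eigenvalues b ^ (j : ℕ)| ≤ tolerance ε s l := by
    intro j
    have h := hQ (.inr (.inl j))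
    rw [Quantity.value_eq, htr, Complex.ofReal_re, Finset.sum_comm] at h
    simpa [Quantity.exponents, Quantity.sensitivity, ← Finset.sum_mul, hcol] using h
  have hQρσ : ∀ i j : Finset.Icc 1 s, |Q (.inr (.inr (i, j))) -
      ∑ a, ∑ b, p a b * hρ.1.isHermitian.eigenvalues a ^ (i : ℕ) *
        hσ.1.isHermitian.eigenvalues b ^ (j : ℕ)| ≤ tolerance ε s 1 := by
    intro i j
    have h := hQ (.inr (.inr (i, j)))
    rw [Quantity.value_eq, htr, Complex.ofReal_re] at h
    simpa [Quantity.exponents, Quantity.sensitivity] using h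
  have hk' : (1 : ℝ) ≤ k := by exact_mod_cast hk
  have hl' : (1 : ℝ) ≤ l := by exact_mod_cast hl
  have hs' : (1 : ℝ) ≤ s := by exact_mod_cast hs
  set θ : ℝ := ε / (1000 * (k + l) * s) with hθdef
  have hθ : 0 ≤ θ := by positivity
  have hθkl : (k + l) * s * θ = ε / 1000 := by
    rw [hθdef]; field_simp
  have hηk : k * s ^ 2 * tolerance ε s k = ε / 1000 := by
    rw [tolerance]; field_simp
  have hηl : l * s ^ 2 * tolerance ε s l = ε / 1000 := by
    rw [tolerance]; field_simp
  have hκ : s ^ 2 * tolerance ε s 1 = ε / 1000 := by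
    rw [tolerance]; push_cast; field_simp
  have hηk0 := (tolerance_pos hε hs hk).le
  have hηl0 := (tolerance_pos hε hs hl).le
  have hηks : k * s * tolerance ε s k ≤ ε / 1000 := by
    rw [← hηk]; gcongr; exact le_self_pow₀ hs' two_ne_zero
  have hηls : l * s * tolerance ε s l ≤ ε / 1000 := by
    rw [← hηl]; gcongr; exact le_self_pow₀ hs' two_ne_zero
  have hθk : k * θ ≤ ε / 1000 := by
    rw [← hθkl]
    gcongr
    nlinarith
  have hθl : l * s * θ ≤ ε / 1000 := by
    rw [← hθkl]
    gcongr
    linarith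
  have hθl' : l * θ ≤ ε / 1000 := by
    refine le_trans ?_ hθl
    gcongr
    nlinarith
  have htail' : ∀ {τ : Matrix (Fin d) (Fin d) ℂ} (hτ : τ.IsHermitian),
      (τ.rank ≤ s ∨ (2 : ℝ) / s.factorial ≤ θ) →
      (Finset.univ.filter fun a => hτ.eigenvalues a ≠ 0).card ≤ s ∨
        (2 : ℝ) / s.factorial ≤ θ := fun hτ h => by
    rwa [hτ.card_filter_eigenvalues_ne_zero]
  have h := abs_postProcess_sub_le hρ.1.eigenvalues_nonneg hρ.sum_eigenvalues
    hσ.1.eigenvalues_nonneg hσ.sum_eigenvalues hp hrow hcol hs hηk0 (tolerance_le_one hε1 hs hk)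
    hηl0 (tolerance_le_one hε1 hs hl) (tolerance_pos hε hs le_rfl).le hθ
    (htail' _ (htail.imp_left And.left)) (htail' _ (htail.imp_left And.right))
    (by linarith) (by linarith) hQρ hQσ hQρσ hi hik hj hjl
  rw [htr, ← Complex.ofReal_sub, Complex.norm_real]
  refine h.trans ?_
  linarith

/-- Rounding down loses at most one in the exponent, so `4 (k + l) / ε ≤ e ^ (L + 1)`; multiplied by
`500 L` this is the required lower bound on `L!`. -/
theorem two_div_factorial_floor_log_le {L₀ : ℕ}
    (hL₀ : ∀ L ≥ L₀, 500 * (L : ℝ) * Real.exp (L + 1) ≤ L.factorial) (hε : 0 < ε)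
    (hk : 1 ≤ k) (hL : L₀ ≤ ⌊Real.log ((4 * (k : ℝ) + 4 * (l : ℝ)) / ε)⌋₊)
    (hpos : 1 ≤ ⌊Real.log ((4 * (k : ℝ) + 4 * (l : ℝ)) / ε)⌋₊) :
    (2 : ℝ) / (⌊Real.log ((4 * (k : ℝ) + 4 * (l : ℝ)) / ε)⌋₊).factorial ≤
      ε / (1000 * (k + l) * ⌊Real.log ((4 * (k : ℝ) + 4 * (l : ℝ)) / ε)⌋₊) := by
  have hk' : (1 : ℝ) ≤ k := by exact_mod_cast hk
  have h1 : Real.log ((4 * (k : ℝ) + 4 * (l : ℝ)) / ε) <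
      ⌊Real.log ((4 * (k : ℝ) + 4 * (l : ℝ)) / ε)⌋₊ + 1 := Nat.lt_floor_add_one _
  generalize ⌊Real.log ((4 * (k : ℝ) + 4 * (l : ℝ)) / ε)⌋₊ = L at *
  have hL' : (1 : ℝ) ≤ L := by exact_mod_cast hpos
  have h2 : (4 * (k : ℝ) + 4 * (l : ℝ)) / ε ≤ Real.exp (L + 1) :=
    (Real.log_le_iff_le_exp (by positivity)).1 h1.le
  rw [div_le_iff₀ hε] at h2
  rw [div_le_div_iff₀ (by positivity) (by positivity)]
  have h3 := mul_le_mul_of_nonneg_right (hL₀ L hL) hε.le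
  have h4 := mul_le_mul_of_nonneg_left h2 (show (0 : ℝ) ≤ 500 * L by positivity)
  linarith

theorem floor_log_le_two_mul_one_add_log (hε : 0 < ε) (hε1 : ε < 1) (hk : 1 ≤ k) (hl : 1 ≤ l) :
    (⌊Real.log ((4 * (k : ℝ) + 4 * (l : ℝ)) / ε)⌋₊ : ℝ) ≤
      2 * (1 + Real.log (((k : ℝ) + l) / ε)) := by
  have hk' : (1 : ℝ) ≤ k := by exact_mod_cast hk
  have hl' : (1 : ℝ) ≤ l := by exact_mod_cast hl
  have h1 : 1 ≤ ((k : ℝ) + l) / ε := by rw [one_le_div hε]; linarith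
  have h0 := Real.log_nonneg h1
  have hlog : Real.log ((4 * (k : ℝ) + 4 * (l : ℝ)) / ε) =
      2 * Real.log 2 + Real.log (((k : ℝ) + l) / ε) := by
    rw [show (4 * (k : ℝ) + 4 * (l : ℝ)) / ε = 2 ^ 2 * (((k : ℝ) + l) / ε) by ring,
      Real.log_mul (by norm_num) (by positivity), Real.log_pow]
    norm_num
  have hlog2 := Real.log_two_lt_d9
  have hlog2' := Real.log_two_gt_d9
  refine (Nat.floor_le (by rw [hlog]; linarith)).trans ?_
  rw [hlog]
  linarith

end Accuracy

theorem theorem5 :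
    ∃ C : ℝ, 0 < C ∧ ∃ c K₀ : ℕ,
      ∀ k l : ℕ, 1 ≤ k → 1 ≤ l → K₀ ≤ k + l →
      ∀ ε δ : ℝ, 0 < ε → ε < 1 → 0 < δ → δ < 1 →
      ∀ t : ℕ, ∃ P : Protocol,
        P.cutoff = min t ⌊Real.log ((4 * (k : ℝ) + 4 * (l : ℝ)) / ε)⌋₊ ∧
        (∀ (q : Quantity P.cutoff) (d : ℕ) (ρ σ : Matrix (Fin d) (Fin d) ℂ),
          IsDensityMatrix ρ → IsDensityMatrix σ →
          ((∑ x, (P.circuit q).outcomeProb ρ σ x * (P.circuit q).signValue x : ℝ) : ℂ) =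
            q.value ρ σ) ∧
        (∀ (q : Quantity P.cutoff) (n : ℕ), 1 ≤ n →
          ((P.circuit q).qubits n : ℝ) ≤ C * (n * t)) ∧
        (∀ q : Quantity P.cutoff, ((P.circuit q).cswaps : ℝ) ≤ C * t) ∧
        (P.copies .rho : ℝ) ≤
          C * ((k : ℝ) ^ 2 / ε ^ 2) * (1 + Real.log (((k : ℝ) + l) / ε)) ^ c *
            Real.log (2 / δ) ∧
        (P.copies .sigma : ℝ) ≤
          C * ((l : ℝ) ^ 2 / ε ^ 2) * (1 + Real.log (((k : ℝ) + l) / ε)) ^ c *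
            Real.log (2 / δ) ∧
        ∀ (d : ℕ) (ρ σ : Matrix (Fin d) (Fin d) ℂ),
          IsDensityMatrix ρ → IsDensityMatrix σ →
          min (max ρ.rank σ.rank) ⌊Real.log ((4 * (k : ℝ) + 4 * (l : ℝ)) / ε)⌋₊ ≤ t →
          ENNReal.ofReal (1 - δ) ≤
            P.law ρ σ {ω | ∀ i j : ℕ, 1 ≤ i → i ≤ k → 1 ≤ j → j ≤ l →
              ‖(P.output ω i j : ℂ) - (ρ ^ i * σ ^ j).trace‖ ≤ ε} := by
  obtain ⟨L₀, hL₀1, hL₀⟩ := exists_forall_mul_exp_le_factorial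
  -- The copy bound is `54 * 10 ^ 6` times `s ^ 9`, and `s ≤ L ≤ 2 (1 + log ((k + l) / ε))` supplies
  -- `2 ^ 9` and the exponent 9. The threshold on `k + l` forces `L ≥ L₀`.
  refine ⟨54 * 10 ^ 6 * 2 ^ 9, by norm_num, 9, ⌈Real.exp L₀⌉₊, ?_⟩
  intro k l hk hl hK ε δ hε hε1 hδ hδ1 t
  have hk' : (1 : ℝ) ≤ k := by exact_mod_cast hk
  have hl' : (1 : ℝ) ≤ l := by exact_mod_cast hl
  have hlogδ : 0 ≤ Real.log (2 / δ) := by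
    refine Real.log_nonneg ?_
    rw [one_le_div hδ]; linarith
  have hLge : L₀ ≤ ⌊Real.log ((4 * (k : ℝ) + 4 * (l : ℝ)) / ε)⌋₊ := by
    have h1 : Real.exp L₀ ≤ k + l := by
      refine (Nat.le_ceil _).trans ?_
      exact_mod_cast hK
    refine Nat.le_floor ?_
    rw [Real.le_log_iff_exp_le (by positivity), le_div_iff₀ hε]
    nlinarith [Real.exp_pos L₀]
  have htail := two_div_factorial_floor_log_le (k := k) (l := l) hL₀ hε hk hLge (hL₀1.trans hLge)
  have hLle := floor_log_le_two_mul_one_add_log hε hε1 hk hl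
  have hLpos := hL₀1.trans hLge
  generalize ⌊Real.log ((4 * (k : ℝ) + 4 * (l : ℝ)) / ε)⌋₊ = L at *
  set s := min t L with hs
  have hst : s ≤ t := min_le_left _ _
  have hsL : (s : ℝ) ≤ L := by exact_mod_cast min_le_right t L
  have hcopies : ∀ K : ℕ, 54 * 10 ^ 6 * ((K : ℝ) ^ 2 / ε ^ 2) * s ^ 9 * Real.log (2 / δ) ≤
      54 * 10 ^ 6 * 2 ^ 9 * ((K : ℝ) ^ 2 / ε ^ 2) *
        (1 + Real.log (((k : ℝ) + l) / ε)) ^ 9 * Real.log (2 / δ) := by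
    intro K
    refine mul_le_mul_of_nonneg_right ?_ hlogδ
    have h9 : (s : ℝ) ^ 9 ≤ (2 * (1 + Real.log (((k : ℝ) + l) / ε))) ^ 9 := by
      gcongr
      exact hsL.trans hLle
    rw [mul_pow] at h9
    have := mul_le_mul_of_nonneg_left h9
      (show (0 : ℝ) ≤ 54 * 10 ^ 6 * ((K : ℝ) ^ 2 / ε ^ 2) by positivity)
    linarith
  refine ⟨momentProtocol k l ε δ s, rfl, ?_, ?_, ?_, ?_, ?_, ?_⟩
  · intro (q : Quantity s) d ρ σ hρ hσ
    exact (momentCircuit_expectation hρ hσ q.exponents_bounds.1).trans (q.value_eq ρ σ).symm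
  · intro (q : Quantity s) n hn
    have hq := q.exponents_bounds
    change ((1 + (q.exponents.1 + q.exponents.2) * n : ℕ) : ℝ) ≤ _
    have ht : 1 ≤ t := q.one_le_cutoff.trans hst
    have h1 : 1 ≤ n * t := Nat.one_le_iff_ne_zero.2 (by positivity)
    have h2 : (q.exponents.1 + q.exponents.2) * n ≤ (2 * t) * n :=
      Nat.mul_le_mul_right _ (by omega)
    have h3 : 1 + (q.exponents.1 + q.exponents.2) * n ≤ 3 * (n * t) := by
      have : 2 * t * n = 2 * (n * t) := by ring
      omega
    have h4 : ((1 + (q.exponents.1 + q.exponents.2) * n : ℕ) : ℝ) ≤ 3 * ((n : ℝ) * t) := by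
      exact_mod_cast h3
    refine h4.trans ?_
    gcongr
    norm_num
  · intro (q : Quantity s)
    have hq := q.exponents_bounds
    have h1 : (momentCircuit q.exponents.1 q.exponents.2).cswaps ≤ 2 * t :=
      (momentCircuit_cswaps_le _ _).trans (by omega)
    have h2 : ((momentCircuit q.exponents.1 q.exponents.2).cswaps : ℝ) ≤ 2 * (t : ℝ) := by
      exact_mod_cast h1
    refine h2.trans ?_
    gcongr
    norm_num
  · exact (momentProtocol_copies_rho_le hε hε1 hδ hδ1 hk hl).trans (hcopies k)
  · exact (momentProtocol_copies_sigma_le hε hε1 hδ hδ1 hk hl).trans (hcopies l)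
  · intro d ρ σ hρ hσ hrank
    have hρ0 := hρ.rank_ne_zero
    -- A state has nonzero rank and `L ≥ 1`, so the rank hypothesis forces `t ≥ 1`.
    have hs1 : 1 ≤ s := by omega
    refine momentProtocol_law_ge hε hδ hδ1 hk hl hs1 hρ hσ fun ω hω i j hi hik hj hjl => ?_
    refine norm_postProcess_sub_trace_le hε hε1 hk hl hs1 hρ hσ ?_ hω hi hik hj hjl
    by_cases hr : max ρ.rank σ.rank ≤ s
    · exact Or.inl ⟨(le_max_left _ _).trans hr, (le_max_right _ _).trans hr⟩
    -- If `s` were `t < L`, the rank hypothesis would put both ranks below `s`; so here the cutoff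
    -- is `L` and factorial decay applies.
    · have hsL' : s = L := by omega
      rw [hsL']
      exact Or.inr htail
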